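/- All graphs are finite, simple, undirected and connected. For adjacent vertices $u,v$ of a graph $\Gamma$ let $W_{u,v}=\{x\in V(\Gamma) : d(x,u)<d(x,v)\}$, where $d(\cdot,\cdot)$ is the graph distance. The graph $\Gamma$ is called nicely distance-balanced (NDB) if there is a positive integer $\gamma=\gamma(\Gamma)$ such that $|W_{u,v}|=|W_{v,u}|=\gamma$ for every pair of adjacent vertices $u,v$ of $\Gamma$. Theorem. Let $\Gamma$ be a regular NDB graph with valency $k=3$, diameter $d\ge 3$ and $\gamma(\Gamma)=d+1$. Then $\Gamma$ is isomorphic to the $3$-dimensional hypercube $Q_3$. -/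

import Mathlib

namespace SimpleGraph

/-- The set `W_{u,v}` of vertices that are closer to `u` than to `v`. -/
def closerSet {V : Type*} (G : SimpleGraph V) (u v : V) : Set V :=
  {x | G.dist x u < G.dist x v}

/-- `G` is nicely distance-balanced with constant `γ`: the graph is connected, `γ` is a positive
integer, and for any two adjacent vertices `u`, `v` exactly `γ` vertices are closer to `u` than to
`v` and exactly `γ` vertices are closer to `v` than to `u`. (For finite graphs `Set.ncard` is the
usual number of elements.) -/
structure IsNicelyDistanceBalanced {V : Type*} (G : SimpleGraph V) (γ : ℕ) : Prop where
  connected : G.Connected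
  pos : 0 < γ
  ncard_eq : ∀ u v : V, G.Adj u v →
    (G.closerSet u v).ncard = γ ∧ (G.closerSet v u).ncard = γ

/-- The `n`-dimensional hypercube `Q_n`: the vertices are the binary words of length `n`, and two
words are adjacent when they differ in exactly one position. -/
def hypercube (n : ℕ) : SimpleGraph (Fin n → Bool) where
  Adj x y := hammingDist x y = 1
  symm := ⟨fun x y h => by rw [hammingDist_comm]; exact h⟩
  loopless := ⟨fun x h => by simp at h⟩

end SimpleGraph

/-!
The proof counts vertices closer to one end of an edge than to the other.

A triangle cannot occur (`IsNicelyDistanceBalanced.not_triangle`). Divide the vertices by their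
nearest corners of a triangle `a b c`. Comparing the counts for the edges of the triangle with those
for the edges to the third neighbors of the corners shows that, outside of the three classes with a
unique nearest corner, next to nothing is left, and that these classes are joined by very few edges.
Three cases remain, each of which is refuted by one more edge count or by a parity argument on the
three corners.

In a triangle-free graph, let `x 0, ..., x d` be a geodesic whose length is the diameter. The vertices
`x 1, ..., x d` and the neighbor of `x 1` off the geodesic are `d + 1` vertices closer to `x 1` than to
`x 0`, hence all of them (`IsTightCubic.eq_of_dist_lt`). Applied at both ends of the geodesic, this
puts the neighbor `y` of `x 2` off the geodesic on a second geodesic from `x 0` to `x d`. For `d ≥ 5`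
there are then too many vertices closer to `x 2` than to `x 1` (`IsTightCubic.false_of_five_le`). For
`d = 4` there are exactly as many as allowed, which determines so much of the graph that a vertex gets
four neighbors (`IsTightCubic.false_of_geodesicFour`).

For `d = 3`, each edge `uv` has exactly one vertex at distance two from `v` and three from `u`
(`IsTightCubic.exists_far`). Without squares, the sphere of radius two around a vertex would induce a
graph with odd degree sum nine (`IsTightCubic.exists_square`), and with a square the same property
leaves only the cube (`IsSquare.nonempty_iso`).
-/

namespace SimpleGraph

variable {V : Type*} {G : SimpleGraph V}

/-! ### Distances, geodesics and cubic graphs -/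

theorem Connected.dist_le_dist_add_one (hG : G.Connected) {x y : V} (h : G.Adj x y) (t : V) :
    G.dist x t ≤ G.dist y t + 1 := by
  have := hG.dist_triangle (u := x) (v := y) (w := t)
  rw [dist_eq_one_iff_adj.2 h] at this
  omega

theorem Connected.dist_le_dist_add_one' (hG : G.Connected) {x y : V} (h : G.Adj x y) (t : V) :
    G.dist t x ≤ G.dist t y + 1 := by
  rw [dist_comm, dist_comm (u := t)]
  exact hG.dist_le_dist_add_one h t

theorem Connected.exists_adj_dist_eq (hG : G.Connected) {x t : V} (h : x ≠ t) :
    ∃ y, G.Adj x y ∧ G.dist x t = G.dist y t + 1 := by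
  obtain ⟨p, hp⟩ := hG.exists_walk_length_eq_dist x t
  cases p with
  | nil => exact absurd rfl h
  | @cons _ y _ hxy p =>
    refine ⟨y, hxy, ?_⟩
    have h1 := dist_le p
    have h2 := hG.dist_le_dist_add_one hxy t
    rw [Walk.length_cons] at hp
    omega

/-- A geodesic that leaves a set `S` does so along an edge `yy'` with `y ∈ S` and `y' ∉ S`. -/
theorem Connected.exists_crossing (hG : G.Connected) {S : Set V} {x t : V} (hx : x ∈ S)
    (ht : t ∉ S) :
    ∃ y ∈ S, ∃ y' ∉ S, G.Adj y y' ∧ G.dist x y + 1 + G.dist y' t ≤ G.dist x t := by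
  induction h : G.dist x t generalizing x with
  | zero =>
    rw [hG.dist_eq_zero_iff] at h
    exact absurd (h ▸ hx) ht
  | succ n ih =>
    have hne : x ≠ t := fun e => ht (e ▸ hx)
    obtain ⟨y, hxy, hy⟩ := hG.exists_adj_dist_eq hne
    by_cases hyS : y ∈ S
    · obtain ⟨u, hu, u', hu', hadj, hle⟩ := ih hyS (by omega)
      have := hG.dist_le_dist_add_one hxy u
      exact ⟨u, hu, u', hu', hadj, by omega⟩
    · refine ⟨x, hx, y, hyS, hxy, ?_⟩
      rw [dist_self]
      omega

theorem exists_third_neighbor [Fintype V] [DecidableRel G.Adj] (hcub : G.IsRegularOfDegree 3)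
    {a u v : V} (hu : G.Adj a u) (hv : G.Adj a v) (huv : u ≠ v) :
    ∃ z, G.Adj a z ∧ z ≠ u ∧ z ≠ v ∧ ∀ y, G.Adj a y → y = u ∨ y = v ∨ y = z := by
  classical
  have h3 : (G.neighborFinset a).card = 3 := hcub a
  obtain ⟨z, hz⟩ : ∃ z, ((G.neighborFinset a).erase u).erase v = {z} := by
    rw [← Finset.card_eq_one, Finset.card_erase_of_mem, Finset.card_erase_of_mem, h3]
    · simpa using hu
    · simpa using ⟨huv.symm, hv⟩
  have hmem : ∀ y, y ∈ ((G.neighborFinset a).erase u).erase v ↔ y = z := by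
    intro y; rw [hz, Finset.mem_singleton]
  simp only [Finset.mem_erase, mem_neighborFinset] at hmem
  obtain ⟨h1, h2, h4⟩ := (hmem z).2 rfl
  refine ⟨z, h4, h2, h1, fun y hy => ?_⟩
  have := hmem y
  tauto

theorem exists_neighbors [Fintype V] [DecidableRel G.Adj] (hcub : G.IsRegularOfDegree 3)
    {a u : V} (hu : G.Adj a u) :
    ∃ v w, G.Adj a v ∧ G.Adj a w ∧ v ≠ u ∧ w ≠ u ∧ w ≠ v ∧
      ∀ y, G.Adj a y → y = u ∨ y = v ∨ y = w := by
  classical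
  have h3 : (G.neighborFinset a).card = 3 := hcub a
  obtain ⟨v, hv⟩ : ((G.neighborFinset a).erase u).Nonempty := by
    rw [← Finset.card_pos, Finset.card_erase_of_mem (by simpa using hu), h3]
    norm_num
  simp only [Finset.mem_erase, mem_neighborFinset] at hv
  obtain ⟨w, hw, h1, h2, h⟩ := exists_third_neighbor hcub hu hv.2 hv.1.symm
  exact ⟨v, w, hv.2, hw, hv.1, h1, h2, h⟩

theorem ncard_setOf_eq_sum [Fintype V] (p : V → Prop) [DecidablePred p] :
    {x | p x}.ncard = ∑ x, if p x then 1 else 0 := by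
  rw [← Finset.card_filter, ← Set.ncard_coe_finset]
  congr 1
  ext x
  simp

theorem IsNicelyDistanceBalanced.ncard_dist_lt {γ : ℕ} (h : G.IsNicelyDistanceBalanced γ)
    {u v : V} (huv : G.Adj u v) : {x | G.dist x u < G.dist x v}.ncard = γ :=
  (h.ncard_eq u v huv).1

/-- The three corners `a`, `b`, `c` of a triangle, with `a'`, `b'`, `c'` the third neighbors of the
corners. -/
structure IsCubicTriangle (G : SimpleGraph V) (a b c a' b' c' : V) : Prop where
  ab : G.Adj a b
  ac : G.Adj a c
  bc : G.Adj b c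
  aa' : G.Adj a a'
  bb' : G.Adj b b'
  cc' : G.Adj c c'
  ne_ab : a' ≠ b
  ne_ac : a' ≠ c
  ne_ba : b' ≠ a
  ne_bc : b' ≠ c
  ne_ca : c' ≠ a
  ne_cb : c' ≠ b
  of_adj_a : ∀ y, G.Adj a y → y = b ∨ y = c ∨ y = a'
  of_adj_b : ∀ y, G.Adj b y → y = a ∨ y = c ∨ y = b'
  of_adj_c : ∀ y, G.Adj c y → y = a ∨ y = b ∨ y = c'

theorem IsCubicTriangle.rotate {a b c a' b' c' : V} (h : G.IsCubicTriangle a b c a' b' c') :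
    G.IsCubicTriangle b c a b' c' a' :=
  ⟨h.bc, h.ab.symm, h.ac.symm, h.bb', h.cc', h.aa', h.ne_bc, h.ne_ba, h.ne_cb, h.ne_ca, h.ne_ab,
    h.ne_ac, fun y hy => by have := h.of_adj_b y hy; tauto,
    fun y hy => by have := h.of_adj_c y hy; tauto, h.of_adj_a⟩

theorem IsCubicTriangle.swap {a b c a' b' c' : V} (h : G.IsCubicTriangle a b c a' b' c') :
    G.IsCubicTriangle b a c b' a' c' :=
  ⟨h.ab.symm, h.bc, h.ac, h.bb', h.aa', h.cc', h.ne_ba, h.ne_bc, h.ne_ab, h.ne_ac, h.ne_cb, h.ne_ca,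
    h.of_adj_b, h.of_adj_a,
    fun y hy => by have := h.of_adj_c y hy; tauto⟩

theorem IsCubicTriangle.dist_lt (hG : G.Connected) {a b c a' b' c' : V}
    (h : G.IsCubicTriangle a b c a' b' c') {x : V} (hx : x ≠ a)
    (hb : G.dist x a ≤ G.dist x b) (hc : G.dist x a ≤ G.dist x c) :
    G.dist x a' < G.dist x a := by
  obtain ⟨y, hy, hd⟩ := hG.exists_adj_dist_eq hx.symm
  rw [dist_comm, dist_comm (u := y)] at hd
  rcases h.of_adj_a y hy with rfl | rfl | rfl <;> omega

/-- The vertices that have a geodesic to `a` through `a'` although `a` is not a nearest corner. -/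
def detour (G : SimpleGraph V) (a b c a' : V) : Set V :=
  {x | G.dist x a' < G.dist x a ∧ (G.dist x b < G.dist x a ∨ G.dist x c < G.dist x a)}

theorem IsCubicTriangle.ncard_eq [Fintype V] {γ : ℕ} (hN : G.IsNicelyDistanceBalanced γ)
    {a b c a' b' c' : V} (h : G.IsCubicTriangle a b c a' b' c') :
    {x | G.dist x a < G.dist x b ∧ G.dist x a < G.dist x c}.ncard +
      {x | G.dist x a = G.dist x b ∧ G.dist x a < G.dist x c}.ncard = γ ∧
    {x | G.dist x a < G.dist x b ∧ G.dist x a < G.dist x c}.ncard +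
      {x | G.dist x a = G.dist x c ∧ G.dist x a < G.dist x b}.ncard = γ ∧
    {x | G.dist x a < G.dist x b ∧ G.dist x a < G.dist x c}.ncard +
      {x | G.dist x a = G.dist x b ∧ G.dist x a < G.dist x c}.ncard +
      {x | G.dist x a = G.dist x c ∧ G.dist x a < G.dist x b}.ncard +
      {x | G.dist x a = G.dist x b ∧ G.dist x a = G.dist x c}.ncard +
      (G.detour a b c a').ncard = γ + 1 := by
  classical
  have hG := hN.connected
  refine ⟨?_, ?_, ?_⟩
  · rw [← hN.ncard_dist_lt h.ac]
    simp only [ncard_setOf_eq_sum]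
    rw [← Finset.sum_add_distrib]
    refine Finset.sum_congr rfl fun x _ => ?_
    have h1 := hG.dist_le_dist_add_one' h.ab x
    have h2 := hG.dist_le_dist_add_one' h.ac.symm x
    have h3 := hG.dist_le_dist_add_one' h.bc.symm x
    split_ifs <;> omega
  · rw [← hN.ncard_dist_lt h.ab]
    simp only [ncard_setOf_eq_sum]
    rw [← Finset.sum_add_distrib]
    refine Finset.sum_congr rfl fun x _ => ?_
    have h1 := hG.dist_le_dist_add_one' h.ac x
    have h2 := hG.dist_le_dist_add_one' h.ab.symm x
    have h3 := hG.dist_le_dist_add_one' h.bc x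
    split_ifs <;> omega
  · have h0 : ∑ x, (if x = a then 1 else 0) = 1 := by simp
    rw [← hN.ncard_dist_lt h.aa'.symm, ← h0, detour]
    simp only [ncard_setOf_eq_sum]
    simp only [← Finset.sum_add_distrib]
    refine Finset.sum_congr rfl fun x _ => ?_
    by_cases hx : x = a
    · subst hx
      have h1 : G.dist x b = 1 := dist_eq_one_iff_adj.2 h.ab
      have h2 : G.dist x c = 1 := dist_eq_one_iff_adj.2 h.ac
      simp [h1, h2]
    · have := h.dist_lt hG hx
      split_ifs <;> omega

/-! ### Triangles split by nearest corners -/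

theorem IsCubicTriangle.exists_mem_detour (hG : G.Connected) {a b c a' b' c' : V}
    (h : G.IsCubicTriangle a b c a' b' c')
    (hab : ∀ x, ¬ (G.dist x a = G.dist x b ∧ G.dist x a ≤ G.dist x c))
    (hac : ∀ x, ¬ (G.dist x a = G.dist x c ∧ G.dist x a ≤ G.dist x b))
    (hbc : ∀ x, ¬ (G.dist x b = G.dist x c ∧ G.dist x b ≤ G.dist x a))
    (hsub : (G.detour a b c a').Subsingleton) (x : V) (hx : x ∈ G.detour a b c a')
    (hxb : G.dist x b < G.dist x a) : ∃ y ∈ G.detour b a c b', G.dist y a < G.dist y b := by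
  have hxa : G.dist x a' < G.dist x a := hx.1
  have e1 := hG.dist_le_dist_add_one' h.aa' x
  have e2 := hG.dist_le_dist_add_one' h.ab x
  have hxa' : x ≠ a' := by
    rintro rfl
    rw [dist_self] at e1
    exact h.ne_ab (hG.dist_eq_zero_iff.1 (by omega))
  have hxb' : x ≠ b := by
    rintro rfl
    rw [dist_self] at e2
    exact h.ne_ab (hG.dist_eq_zero_iff.1 (by omega)).symm
  obtain ⟨y, hxy, hy⟩ := hG.exists_adj_dist_eq hxa'
  have e3 := hG.dist_le_dist_add_one hxy a
  have e4 := hG.dist_le_dist_add_one' h.aa' y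
  have e5 := hG.dist_le_dist_add_one hxy b'
  have e6 := hG.dist_le_dist_add_one hxy.symm b'
  have e7 := hG.dist_le_dist_add_one' h.ab y
  have e8 := hG.dist_le_dist_add_one' h.ab.symm y
  have e9 := hbc x
  have e10 := hG.dist_le_dist_add_one' h.bc x
  have e11 := hG.dist_le_dist_add_one' h.ac x
  have e12 := h.swap.dist_lt hG hxb' (by omega) (by omega)
  by_cases hmin : G.dist y b < G.dist y a ∨ G.dist y c < G.dist y a
  · exact absurd (hsub hx ⟨by omega, hmin⟩) hxy.ne
  · have := hab y
    have := hac y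
    exact ⟨y, ⟨by omega, by omega⟩, by omega⟩

theorem detour_comm (a b c a' : V) : G.detour a b c a' = G.detour a c b a' := by
  ext x
  simp [detour, or_comm]

/-- Without ties between the corners, the corners cannot have exactly one detour vertex each: if
the detour vertex of `a` is nearest to `b`, then that of `b` is nearest to `a`, which would pair off
the three corners. -/
theorem IsCubicTriangle.false_of_detour_eq_singleton (hG : G.Connected) {a b c a' b' c' : V}
    (h : G.IsCubicTriangle a b c a' b' c')
    (hab : ∀ x, ¬ (G.dist x a = G.dist x b ∧ G.dist x a ≤ G.dist x c))
    (hac : ∀ x, ¬ (G.dist x a = G.dist x c ∧ G.dist x a ≤ G.dist x b))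
    (hbc : ∀ x, ¬ (G.dist x b = G.dist x c ∧ G.dist x b ≤ G.dist x a)) {x y z : V}
    (hx : G.detour a b c a' = {x}) (hy : G.detour b c a b' = {y})
    (hz : G.detour c a b c' = {z}) : False := by
  have hab' : ∀ x, ¬ (G.dist x b = G.dist x a ∧ G.dist x b ≤ G.dist x c) := fun x => by
    have := hab x; omega
  have hac' : ∀ x, ¬ (G.dist x c = G.dist x a ∧ G.dist x c ≤ G.dist x b) := fun x => by
    have := hac x; omega
  have hbc' : ∀ x, ¬ (G.dist x c = G.dist x b ∧ G.dist x c ≤ G.dist x a) := fun x => by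
    have := hbc x; omega
  have hx' := hx
  have hy' := hy
  have hz' := hz
  rw [detour_comm] at hx' hy' hz'
  have h12 := h.exists_mem_detour hG hab hac hbc (by simp [hx]) x (by simp [hx])
  have h13 := h.rotate.rotate.swap.exists_mem_detour hG hac hab hbc' (by simp [hx']) x
    (by simp [hx'])
  have h21 := h.swap.exists_mem_detour hG hab' hbc hac (by simp [hy']) y (by simp [hy'])
  have h23 := h.rotate.exists_mem_detour hG hbc hab' hac' (by simp [hy]) y (by simp [hy])
  have h31 := h.rotate.rotate.exists_mem_detour hG hac' hbc' hab (by simp [hz]) z (by simp [hz])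
  have h32 := h.rotate.swap.exists_mem_detour hG hbc' hac' hab' (by simp [hz']) z (by simp [hz'])
  simp only [hx, hx', hy, hy', hz, hz', Set.mem_singleton_iff, exists_eq_left]
    at h12 h13 h21 h23 h31 h32
  have ex : x ∈ G.detour a b c a' := by simp [hx]
  have ey : y ∈ G.detour b c a b' := by simp [hy]
  have ez : z ∈ G.detour c a b c' := by simp [hz]
  have ex := ex.2
  have ey := ey.2
  have ez := ez.2
  have l1 := hG.dist_le_dist_add_one' h.ab x
  have l2 := hG.dist_le_dist_add_one' h.ac x
  have l3 := hG.dist_le_dist_add_one' h.ab.symm y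
  have l4 := hG.dist_le_dist_add_one' h.bc y
  have l5 := hG.dist_le_dist_add_one' h.ac.symm z
  have l6 := hG.dist_le_dist_add_one' h.bc.symm z
  have := hbc x
  have := hac y
  have := hab z
  omega

/-- A triangle in which geodesics to a corner through its third neighbor start only at vertices
with that corner as a nearest corner; `μ` is the distance to the triangle. -/
structure IsCubicTriangle.Split (G : SimpleGraph V) (μ : V → ℕ) (a b c a' b' c' : V) : Prop where
  conn : G.Connected
  triangle : G.IsCubicTriangle a b c a' b' c'
  le_a : ∀ x, μ x ≤ G.dist x a
  le_b : ∀ x, μ x ≤ G.dist x b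
  le_c : ∀ x, μ x ≤ G.dist x c
  nearest : ∀ x, G.dist x a = μ x ∨ G.dist x b = μ x ∨ G.dist x c = μ x
  split_a : ∀ x, G.dist x a' < G.dist x a → G.dist x a = μ x
  split_b : ∀ x, G.dist x b' < G.dist x b → G.dist x b = μ x
  split_c : ∀ x, G.dist x c' < G.dist x c → G.dist x c = μ x

namespace IsCubicTriangle.Split

variable {μ : V → ℕ} {a b c a' b' c' : V}

theorem rotate (h : Split G μ a b c a' b' c') : Split G μ b c a b' c' a' :=
  ⟨h.conn, h.triangle.rotate, h.le_b, h.le_c, h.le_a, fun x => by have := h.nearest x; tauto,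
    h.split_b, h.split_c, h.split_a⟩

theorem swap (h : Split G μ a b c a' b' c') : Split G μ b a c b' a' c' :=
  ⟨h.conn, h.triangle.swap, h.le_b, h.le_a, h.le_c, fun x => by have := h.nearest x; tauto,
    h.split_b, h.split_a, h.split_c⟩

theorem dist_le (h : Split G μ a b c a' b' c') (x : V) : G.dist x a ≤ μ x + 1 := by
  have := h.nearest x
  have := h.conn.dist_le_dist_add_one' h.triangle.ab x
  have := h.conn.dist_le_dist_add_one' h.triangle.ac x
  omega

theorem dist_lt (h : Split G μ a b c a' b' c') {x : V} (hx : x ≠ a) (hxa : G.dist x a = μ x) :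
    G.dist x a' < G.dist x a :=
  h.triangle.dist_lt h.conn hx (hxa ▸ h.le_b x) (hxa ▸ h.le_c x)

theorem eq_of_adj (h : Split G μ a b c a' b' c') {y : V} (hy : G.Adj y a) (hyb : y ≠ b)
    (hyc : y ≠ c) : G.dist y a = μ y := by
  obtain rfl : y = a' := by have := h.triangle.of_adj_a y hy.symm; tauto
  apply h.split_a
  rw [dist_self, dist_eq_one_iff_adj.2 hy]
  exact one_pos

/-- Vertices other than the corners that are nearest to different corners are adjacent only if one
of them is nearest to both corners. -/
theorem cross (h : Split G μ a b c a' b' c') {x y : V} (hxy : G.Adj x y) (hx : x ≠ a) (hy : y ≠ b)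
    (hxa : G.dist x a = μ x) (hyb : G.dist y b = μ y) :
    G.dist y a = μ y ∨ G.dist x b = μ x := by
  have e1 := h.dist_lt hx hxa
  have e2 := h.swap.dist_lt hy hyb
  have e3 := h.split_a y
  have e4 := h.split_b x
  have e5 := h.conn.dist_le_dist_add_one hxy.symm a'
  have e6 := h.conn.dist_le_dist_add_one hxy b'
  have e7 := h.le_a y
  have e8 := h.le_b x
  omega

/-- Only one vertex is at the same distance from all corners and no other vertex is nearest to two
corners: impossible, as the classes of two corners are then closer to that vertex than to its
neighbor in the class of the third corner. -/
theorem false_of_center [Fintype V] {γ : ℕ} (hN : G.IsNicelyDistanceBalanced γ) (hγ : 2 ≤ γ)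
    (h : Split G μ a b c a' b' c') {o : V} (hoa : G.dist o a = μ o) (hob : G.dist o b = μ o)
    (hoc : G.dist o c = μ o) (hab : ∀ x, G.dist x a = μ x → G.dist x b = μ x → x = o)
    (hac : ∀ x, G.dist x a = μ x → G.dist x c = μ x → x = o)
    (hbc : ∀ x, G.dist x b = μ x → G.dist x c = μ x → x = o)
    (hb : {x | G.dist x b < G.dist x c ∧ G.dist x b < G.dist x a}.ncard = γ)
    (hc : {x | G.dist x c < G.dist x a ∧ G.dist x c < G.dist x b}.ncard = γ) : False := by
  classical
  have hG := h.conn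
  have dab : G.dist a b = 1 := dist_eq_one_iff_adj.2 h.triangle.ab
  have dca : G.dist c a = 1 := dist_eq_one_iff_adj.2 h.triangle.ac.symm
  have dbc : G.dist b c = 1 := dist_eq_one_iff_adj.2 h.triangle.bc
  have hoa' : o ≠ a := by rintro rfl; rw [dist_self] at hoa; omega
  have hob' : o ≠ b := by rintro rfl; rw [dist_self] at hob; omega
  have hoc' : o ≠ c := by rintro rfl; rw [dist_self] at hoc; omega
  obtain ⟨f, hof, hf⟩ := hG.exists_adj_dist_eq hoa'
  have f1 := hG.dist_le_dist_add_one hof b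
  have f2 := hG.dist_le_dist_add_one hof c
  have f3 := h.nearest f
  have f4 := h.le_a f
  have f5 := hab f
  have f6 := hac f
  have f7 : f ≠ o := hof.ne'
  have f8 := h.le_b f
  have f9 := h.le_c f
  have fa : G.dist f a = μ f := by omega
  have fb : G.dist f b ≠ μ f := fun e => f7 (f5 fa e)
  have fc : G.dist f c ≠ μ f := fun e => f7 (f6 fa e)
  have ob' := h.swap.dist_lt hob' hob
  have oc' := h.rotate.rotate.dist_lt hoc' hoc
  have key : ∀ x, x ≠ b → x ≠ c → μ x < G.dist x a → G.dist x o < G.dist x f := by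
    intro x hxb hxc hxa
    obtain ⟨y, ⟨hyb, hyc, hya⟩, y', hy', hyy', hle⟩ :=
      hG.exists_crossing (S := {x | x ≠ b ∧ x ≠ c ∧ μ x < G.dist x a}) (x := x) (t := f)
        ⟨hxb, hxc, hxa⟩ (fun hS => by have := hS.2.2; omega)
    -- The distance from `x` to `o` through a nearest corner can be shortened by two.
    have hxo : G.dist x o + 2 ≤ μ x + μ o := by
      rcases h.nearest x with e | e | e
      · omega
      · have e1 := h.swap.dist_lt hxb e
        have e2 := hG.dist_triangle (u := x) (v := b') (w := o)
        rw [dist_comm (u := b')] at e2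
        omega
      · have e1 := h.rotate.rotate.dist_lt hxc e
        have e2 := hG.dist_triangle (u := x) (v := c') (w := o)
        rw [dist_comm (u := c')] at e2
        omega
    have hcor : ∀ t, y' = t → μ x ≤ G.dist x t → μ o ≤ G.dist t f →
        G.dist x o < G.dist x f := by
      rintro _ rfl e1 e2
      have := hG.dist_le_dist_add_one' hyy'.symm x
      omega
    by_cases hb' : y' = b
    · exact hcor b hb' (h.le_b x) (by rw [dist_comm]; omega)
    by_cases hc' : y' = c
    · exact hcor c hc' (h.le_c x) (by rw [dist_comm]; omega)
    have hya' : G.dist y' a = μ y' := by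
      have := h.le_a y'
      by_contra hne
      exact hy' ⟨hb', hc', by omega⟩
    by_cases ho : y' = o
    · subst ho
      have := hG.dist_le_dist_add_one' hyy'.symm x
      rw [dist_eq_one_iff_adj.2 hof] at hle
      omega
    exfalso
    by_cases ha' : y' = a
    · subst ha'
      have := h.eq_of_adj hyy' hyb hyc
      omega
    rcases h.nearest y with e | e | e
    · omega
    · rcases h.cross hyy'.symm ha' hyb hya' e with e' | e'
      · omega
      · exact ho (hab _ hya' e')
    · rcases h.rotate.rotate.swap.cross hyy'.symm ha' hyc hya' e with e' | e'
      · omega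
      · exact ho (hac _ hya' e')
  have hW := hN.ncard_dist_lt hof
  rw [ncard_setOf_eq_sum] at hW hb hc
  have s1 : ∑ x, (if x = b then 1 else 0) = 1 := by simp
  have s2 : ∑ x, (if x = c then 1 else 0) = 1 := by simp
  have s3 : ∑ x, (if x = o then 1 else 0) = 1 := by simp
  have hle := Finset.sum_le_sum (s := Finset.univ)
    (f := fun x => (if G.dist x b < G.dist x c ∧ G.dist x b < G.dist x a then 1 else 0) +
      (if G.dist x c < G.dist x a ∧ G.dist x c < G.dist x b then 1 else 0) +
      (if x = o then 1 else 0))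
    (g := fun x => (if G.dist x o < G.dist x f then 1 else 0) + (if x = b then 1 else 0) +
      (if x = c then 1 else 0)) (fun x _ => by
        have k := key x
        have l1 := h.le_b x
        have l2 := h.le_c x
        by_cases hxo : x = o
        · have e : G.dist x o < G.dist x f := by
            rw [hxo, dist_self, dist_eq_one_iff_adj.2 hof]
            exact one_pos
          rw [if_neg (by rw [hxo]; omega), if_neg (by rw [hxo]; omega), if_pos hxo, if_pos e]
          omega
        rw [if_neg hxo]
        by_cases hxb : x = b
        · rw [if_pos hxb]
          split_ifs <;> omega
        by_cases hxc : x = c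
        · rw [if_pos hxc]
          split_ifs <;> omega
        have k' := k hxb hxc
        split_ifs <;> omega)
  simp only [Finset.sum_add_distrib] at hle
  omega

end IsCubicTriangle.Split

/-! ### Triangles with ties between the corners -/

namespace IsCubicTriangle

/-- A split triangle in which any two corners have exactly one common vertex with just these two
as nearest corners: `p` for `a`, `b`, then `q` for `a`, `c`, and `r` for `b`, `c`. -/
structure Ties (G : SimpleGraph V) (μ : V → ℕ) (a b c a' b' c' p q r : V) : Prop where
  split : Split G μ a b c a' b' c'
  pa : G.dist p a = μ p
  pb : G.dist p b = μ p
  pc : G.dist p c ≠ μ p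
  qa : G.dist q a = μ q
  qb : G.dist q b ≠ μ q
  qc : G.dist q c = μ q
  ra : G.dist r a ≠ μ r
  rb : G.dist r b = μ r
  rc : G.dist r c = μ r
  eq_p : ∀ x, G.dist x a = μ x → G.dist x b = μ x → x = p
  eq_q : ∀ x, G.dist x a = μ x → G.dist x c = μ x → x = q
  eq_r : ∀ x, G.dist x b = μ x → G.dist x c = μ x → x = r

namespace Ties

variable {μ : V → ℕ} {a b c a' b' c' p q r : V}

theorem rotate (h : Ties G μ a b c a' b' c' p q r) : Ties G μ b c a b' c' a' r p q :=
  ⟨h.split.rotate, h.rb, h.rc, h.ra, h.pb, h.pc, h.pa, h.qb, h.qc, h.qa, h.eq_r,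
    fun x h1 h2 => h.eq_p x h2 h1, fun x h1 h2 => h.eq_q x h2 h1⟩

theorem swap (h : Ties G μ a b c a' b' c' p q r) : Ties G μ b a c b' a' c' p r q :=
  ⟨h.split.swap, h.pb, h.pa, h.pc, h.rb, h.ra, h.rc, h.qb, h.qa, h.qc,
    fun x h1 h2 => h.eq_p x h2 h1, h.eq_r, h.eq_q⟩

/-- The class of a corner `a` is joined to the rest of the graph only through `a` and the two
tie vertices of `a`. -/
theorem of_adj (h : Ties G μ a b c a' b' c' p q r) {y y' : V} (hyy' : G.Adj y y')
    (hy : y ≠ a ∧ G.dist y a < G.dist y b ∧ G.dist y a < G.dist y c)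
    (hy' : ¬ (y' ≠ a ∧ G.dist y' a < G.dist y' b ∧ G.dist y' a < G.dist y' c)) :
    y' = a ∨ y' = p ∨ y' = q := by
  by_contra! hne
  obtain ⟨ha, hp, hq⟩ := hne
  obtain ⟨hya, h1, h2⟩ := hy
  have hs := h.split
  have lb := hs.le_b y
  have lc := hs.le_c y
  have yb : G.dist y b ≠ μ y := by have := hs.le_a y; omega
  have yc : G.dist y c ≠ μ y := by have := hs.le_a y; omega
  have yna : G.dist y a = μ y := by have := hs.nearest y; tauto
  by_cases hna : G.dist y' a = μ y'
  · have lb := hs.le_b y'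
    have lc := hs.le_c y'
    have e1 : G.dist y' b ≠ μ y' := fun e => hp (h.eq_p _ hna e)
    have e2 : G.dist y' c ≠ μ y' := fun e => hq (h.eq_q _ hna e)
    exact hy' ⟨ha, by omega, by omega⟩
  have hyb : y ≠ b := by rintro rfl; rw [dist_self] at h1; omega
  have hyc : y ≠ c := by rintro rfl; rw [dist_self] at h2; omega
  rcases hs.nearest y' with e | e | e
  · exact hna e
  · by_cases hb : y' = b
    · subst hb
      exact yb (hs.swap.eq_of_adj hyy' hya hyc)
    · exact (hs.cross hyy' hya hb yna e).elim hna yb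
  · by_cases hc : y' = c
    · subst hc
      exact yc (hs.rotate.rotate.eq_of_adj hyy' hya hyb)
    · exact (hs.rotate.rotate.swap.cross hyy' hya hc yna e).elim hna yc

/-- If `g` is the only neighbor of `p` in the class of `b`, then some geodesic from `p` to `r`
passes through `q`: otherwise the whole class of `b`, together with `c` and `r`, would be closer to
`g` than to `p`. -/
theorem dist_add_dist_le [Fintype V] {γ : ℕ} (hN : G.IsNicelyDistanceBalanced γ)
    (h : Ties G μ a b c a' b' c' p q r)
    (hcard : {x | G.dist x b < G.dist x c ∧ G.dist x b < G.dist x a}.ncard + 1 = γ) {g : V}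
    (hpg : G.Adj p g) (hg : G.dist p b = G.dist g b + 1)
    (hnbr : ∀ y, G.Adj p y → y = g ∨ G.dist y a = μ y) :
    G.dist p q + G.dist q r ≤ G.dist p r := by
  classical
  have hs := h.split
  have hG := hs.conn
  have hpa := h.pa
  have hpb := h.pb
  have hra := h.ra
  have hrb := h.rb
  have hrc := h.rc
  have dbc : G.dist b c = 1 := dist_eq_one_iff_adj.2 hs.triangle.bc
  have hrp : ¬ G.dist r g < G.dist r p := by
    intro hr
    have hc : G.dist c g < G.dist c p := by
      have e1 := hs.le_c p
      have e2 := h.pc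
      have e3 := hG.dist_le_dist_add_one' hs.triangle.bc.symm g
      rw [dist_comm, dist_comm (u := c)]
      omega
    have key : ∀ x, G.dist x b < G.dist x c → G.dist x b < G.dist x a →
        G.dist x g < G.dist x p := by
      intro x h1 h2
      by_cases hxb : x = b
      · rw [hxb, dist_comm, dist_comm (u := b)]
        omega
      obtain ⟨y, hy, y', hy', hyy', hle⟩ :=
        hG.exists_crossing (S := {x | x ≠ b ∧ G.dist x b < G.dist x c ∧ G.dist x b < G.dist x a})
          (x := x) (t := p) ⟨hxb, h1, h2⟩ (fun hS => by have := hS.2.2; omega)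
      rcases h.rotate.of_adj hyy' hy hy' with rfl | rfl | rfl
      · have e1 := hG.dist_le_dist_add_one' hyy'.symm x
        have e2 := hG.dist_triangle (u := x) (v := y') (w := g)
        rw [dist_comm (u := y')] at hle e2
        omega
      · have e1 := hG.dist_le_dist_add_one' hyy'.symm x
        have e2 := hG.dist_triangle (u := x) (v := y') (w := g)
        omega
      · rcases hnbr y hyy'.symm with rfl | e
        · omega
        · have := hy.2.2
          have := hs.le_b y
          omega
    have hW := hN.ncard_dist_lt hpg.symm
    rw [ncard_setOf_eq_sum] at hW hcard
    have s1 : ∑ x, (if x = r then 1 else 0) = 1 := by simp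
    have s2 : ∑ x, (if x = c then 1 else 0) = 1 := by simp
    have hle := Finset.sum_le_sum (s := Finset.univ)
      (f := fun x => (if G.dist x b < G.dist x c ∧ G.dist x b < G.dist x a then 1 else 0) +
        (if x = r then 1 else 0) + (if x = c then 1 else 0))
      (g := fun x => if G.dist x g < G.dist x p then 1 else 0) (fun x _ => by
        have k := key x
        by_cases hxr : x = r
        · subst hxr
          have : x ≠ c := by
            rintro rfl
            rw [dist_self] at hrc
            rw [dist_comm] at hrb
            omega
          rw [if_pos rfl, if_neg this, if_pos hr, if_neg (by omega)]
        by_cases hxc : x = c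
        · subst hxc
          rw [if_pos rfl, if_neg hxr, if_pos hc, dist_self, if_neg (by omega)]
        rw [if_neg hxr, if_neg hxc]
        split_ifs <;> omega)
    simp only [Finset.sum_add_distrib] at hle
    omega
  have hpr : p ≠ r := by
    rintro rfl
    exact hra hpa
  obtain ⟨y, hy, y', hy', hyy', hle⟩ :=
    hG.exists_crossing
      (S := {x | x = p ∨ (x ≠ a ∧ G.dist x a < G.dist x b ∧ G.dist x a < G.dist x c)})
      (x := p) (t := r) (Or.inl rfl) (fun hS => by
        rcases hS with e | e
        · exact hpr e.symm
        · have := hs.le_a r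
          omega)
  have fin : y' = a ∨ y' = q → G.dist p q + G.dist q r ≤ G.dist p r := by
    have e1 := hG.dist_le_dist_add_one' hyy'.symm p
    rintro (rfl | rfl)
    · have e2 := hG.dist_triangle (u := p) (v := b) (w := r)
      have e3 := hs.le_a r
      rw [dist_comm (u := b)] at e2
      rw [dist_comm (u := y')] at hle
      omega
    · omega
  rcases hy with rfl | hy
  · rcases hnbr y' hyy' with rfl | e
    · rw [dist_comm, dist_comm (u := r) (v := y)] at hrp
      omega
    · apply fin
      by_contra! hne
      have e1 := hs.le_b y'
      have e2 := hs.le_c y'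
      have e3 : G.dist y' b ≠ μ y' := fun e' => hyy'.ne' (h.eq_p _ e e')
      have e4 : G.dist y' c ≠ μ y' := fun e' => hne.2 (h.eq_q _ e e')
      exact hy' (Or.inr ⟨hne.1, by omega, by omega⟩)
  · have hyp : y' ≠ p := fun e => hy' (Or.inl e)
    have := h.of_adj hyy' hy (fun e => hy' (Or.inr e))
    tauto

/-- Each tie vertex forces one of its two tie distances to be the sum of the other two. -/
theorem dist_add_dist_le_or [Fintype V] [DecidableRel G.Adj] (hcub : G.IsRegularOfDegree 3)
    {γ : ℕ} (hN : G.IsNicelyDistanceBalanced γ) (h : Ties G μ a b c a' b' c' p q r)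
    (ha : {x | G.dist x a < G.dist x b ∧ G.dist x a < G.dist x c}.ncard + 1 = γ)
    (hb : {x | G.dist x b < G.dist x c ∧ G.dist x b < G.dist x a}.ncard + 1 = γ) :
    G.dist p q + G.dist q r ≤ G.dist p r ∨ G.dist p r + G.dist q r ≤ G.dist p q := by
  have hs := h.split
  have hG := hs.conn
  have hpa := h.pa
  have hpb := h.pb
  have hpc := h.pc
  have dab : G.dist a b = 1 := dist_eq_one_iff_adj.2 hs.triangle.ab
  have hp1 : p ≠ a := by rintro rfl; rw [dist_self] at hpa; omega
  have hp2 : p ≠ b := by rintro rfl; rw [dist_self] at hpb; rw [dist_comm] at hpa; omega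
  have near : ∀ {f g : V}, G.Adj p f → G.Adj p g → G.dist p a = G.dist f a + 1 →
      G.dist p b = G.dist g b + 1 → f ≠ g := by
    rintro f _ hf _ h1 h2 rfl
    have := hs.nearest f
    have := hs.le_a f
    have := hs.le_b f
    have := hs.le_c p
    have := hG.dist_le_dist_add_one hf c
    exact hf.ne' (h.eq_p f (by omega) (by omega))
  obtain ⟨f, hpf, hf⟩ := hG.exists_adj_dist_eq hp1
  obtain ⟨g, hpg, hg⟩ := hG.exists_adj_dist_eq hp2
  have hfg := near hpf hpg hf hg
  obtain ⟨z, hpz, hzf, hzg, hz⟩ := exists_third_neighbor hcub hpf hpg hfg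
  have hfa : G.dist f a = μ f := by
    have := hs.nearest f
    have := hs.le_a f
    have := hs.le_b f
    have := hs.le_c p
    have := hG.dist_le_dist_add_one hpf b
    have := hG.dist_le_dist_add_one hpf c
    omega
  have hgb : G.dist g b = μ g := by
    have := hs.nearest g
    have := hs.le_a f
    have := hs.le_b g
    have := hs.le_c p
    have := hG.dist_le_dist_add_one hpg a
    have := hG.dist_le_dist_add_one hpg c
    omega
  have hzc : G.dist z a = μ z ∨ G.dist z b = μ z := by
    rcases hs.nearest z with e | e | e
    · exact Or.inl e
    · exact Or.inr e
    · by_cases hzc : z = c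
      · subst hzc
        have := hs.le_c p
        have e1 : G.dist p z = 1 := dist_eq_one_iff_adj.2 hpz
        exact absurd (hG.dist_eq_zero_iff.1 (by omega)) hp1
      · rcases hs.rotate.rotate.swap.cross hpz hp1 hzc hpa e with e' | e'
        · exact Or.inl e'
        · exact absurd e' hpc
  rcases hzc with e | e
  · refine Or.inl (h.dist_add_dist_le hN hb hpg hg fun y hy => ?_)
    rcases hz y hy with rfl | rfl | rfl
    · exact Or.inr hfa
    · exact Or.inl rfl
    · exact Or.inr e
  · have := h.swap.dist_add_dist_le hN (by simpa only [and_comm] using ha) hpf hf fun y hy => by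
      rcases hz y hy with rfl | rfl | rfl
      · exact Or.inl rfl
      · exact Or.inr hgb
      · exact Or.inr e
    rw [dist_comm (u := r)] at this
    exact Or.inr this

theorem false [Fintype V] [DecidableRel G.Adj] (hcub : G.IsRegularOfDegree 3)
    {γ : ℕ} (hN : G.IsNicelyDistanceBalanced γ) (h : Ties G μ a b c a' b' c' p q r)
    (ha : {x | G.dist x a < G.dist x b ∧ G.dist x a < G.dist x c}.ncard + 1 = γ)
    (hb : {x | G.dist x b < G.dist x c ∧ G.dist x b < G.dist x a}.ncard + 1 = γ)
    (hc : {x | G.dist x c < G.dist x a ∧ G.dist x c < G.dist x b}.ncard + 1 = γ) : False := by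
  have h1 := h.dist_add_dist_le_or hcub hN ha hb
  have h2 := h.rotate.dist_add_dist_le_or hcub hN hb hc
  have h3 := h.rotate.rotate.dist_add_dist_le_or hcub hN hc ha
  have hpq : 0 < G.dist p q := h.split.conn.pos_dist_of_ne (by rintro rfl; exact h.pc h.qc)
  have hqr : 0 < G.dist q r := h.split.conn.pos_dist_of_ne (by rintro rfl; exact h.qb h.rb)
  have hpr : 0 < G.dist p r := h.split.conn.pos_dist_of_ne (by rintro rfl; exact h.pc h.rc)
  rw [dist_comm (u := r) (v := p), dist_comm (u := r) (v := q)] at h2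
  rw [dist_comm (u := r) (v := p), dist_comm (u := q) (v := p)] at h3
  omega

end Ties

/-- A cubic nicely distance-balanced graph with `γ ≥ 2` contains no triangle. -/
theorem false_of_two_le [Fintype V] [DecidableRel G.Adj] (hcub : G.IsRegularOfDegree 3)
    {γ : ℕ} (hN : G.IsNicelyDistanceBalanced γ) (hγ : 2 ≤ γ) {a b c a' b' c' : V}
    (h : G.IsCubicTriangle a b c a' b' c') : False := by
  have hG := hN.connected
  obtain ⟨a1, a2, a3⟩ := h.ncard_eq hN
  obtain ⟨b1, b2, b3⟩ := h.rotate.ncard_eq hN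
  obtain ⟨c1, c2, c3⟩ := h.rotate.rotate.ncard_eq hN
  -- The tie classes, listed from the point of view of different corners, agree.
  have eab : {x | G.dist x b = G.dist x a ∧ G.dist x b < G.dist x c} =
      {x | G.dist x a = G.dist x b ∧ G.dist x a < G.dist x c} := by
    ext x; simp only [Set.mem_ofPred_eq]; omega
  have eac : {x | G.dist x c = G.dist x a ∧ G.dist x c < G.dist x b} =
      {x | G.dist x a = G.dist x c ∧ G.dist x a < G.dist x b} := by
    ext x; simp only [Set.mem_ofPred_eq]; omega
  have ebc : {x | G.dist x c = G.dist x b ∧ G.dist x c < G.dist x a} =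
      {x | G.dist x b = G.dist x c ∧ G.dist x b < G.dist x a} := by
    ext x; simp only [Set.mem_ofPred_eq]; omega
  have eb : {x | G.dist x b = G.dist x c ∧ G.dist x b = G.dist x a} =
      {x | G.dist x a = G.dist x b ∧ G.dist x a = G.dist x c} := by
    ext x; simp only [Set.mem_ofPred_eq]; omega
  have ec : {x | G.dist x c = G.dist x a ∧ G.dist x c = G.dist x b} =
      {x | G.dist x a = G.dist x b ∧ G.dist x a = G.dist x c} := by
    ext x; simp only [Set.mem_ofPred_eq]; omega
  rw [eab] at b2 b3
  rw [eac] at c1 c3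
  rw [ebc] at c2 c3
  rw [eb] at b3
  rw [ec] at c3
  set AB := {x | G.dist x a = G.dist x b ∧ G.dist x a < G.dist x c} with hAB
  set AC := {x | G.dist x a = G.dist x c ∧ G.dist x a < G.dist x b} with hAC
  set BC := {x | G.dist x b = G.dist x c ∧ G.dist x b < G.dist x a} with hBC
  set ABC := {x | G.dist x a = G.dist x b ∧ G.dist x a = G.dist x c} with hABC
  have mAB : ∀ x, x ∈ AB ↔ G.dist x a = G.dist x b ∧ G.dist x a < G.dist x c := fun _ => Iff.rfl
  have mAC : ∀ x, x ∈ AC ↔ G.dist x a = G.dist x c ∧ G.dist x a < G.dist x b := fun _ => Iff.rfl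
  have mBC : ∀ x, x ∈ BC ↔ G.dist x b = G.dist x c ∧ G.dist x b < G.dist x a := fun _ => Iff.rfl
  have mABC : ∀ x, x ∈ ABC ↔ G.dist x a = G.dist x b ∧ G.dist x a = G.dist x c :=
    fun _ => Iff.rfl
  have emp : ∀ S : Set V, S.ncard = 0 → ∀ x, x ∉ S := by
    intro S hS x hx
    rw [Set.ncard_eq_zero] at hS
    simp [hS] at hx
  -- Without detour vertices the triangle is split.
  have hsplit : (G.detour a b c a').ncard = 0 → (G.detour b c a b').ncard = 0 →
      (G.detour c a b c').ncard = 0 →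
      Split G (fun x => min (G.dist x a) (min (G.dist x b) (G.dist x c))) a b c a' b' c' := by
    intro h1 h2 h3
    refine ⟨hG, h, fun x => ?_, fun x => ?_, fun x => ?_, fun x => ?_, fun x hx => ?_,
      fun x hx => ?_, fun x hx => ?_⟩
    · omega
    · omega
    · omega
    · omega
    · have := emp _ h1 x
      simp only [detour, Set.mem_ofPred_eq] at this
      omega
    · have := emp _ h2 x
      simp only [detour, Set.mem_ofPred_eq] at this
      omega
    · have := emp _ h3 x
      simp only [detour, Set.mem_ofPred_eq] at this
      omega
  obtain h0 | h0 : AB.ncard = 1 ∨ AB.ncard = 0 := by omega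
  · obtain ⟨p, hp⟩ := Set.ncard_eq_one.1 h0
    obtain ⟨q, hq⟩ := Set.ncard_eq_one.1 (show AC.ncard = 1 by omega)
    obtain ⟨r, hr⟩ := Set.ncard_eq_one.1 (show BC.ncard = 1 by omega)
    have mp := (mAB p).1 (by simp [hp])
    have mq := (mAC q).1 (by simp [hq])
    have mr := (mBC r).1 (by simp [hr])
    have hno := emp ABC (by omega)
    have ht : Ties G (fun x => min (G.dist x a) (min (G.dist x b) (G.dist x c)))
        a b c a' b' c' p q r := by
      refine ⟨hsplit (by omega) (by omega) (by omega), by omega, by omega, by omega, by omega,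
        by omega, by omega, by omega, by omega, by omega, fun x h1 h2 => ?_, fun x h1 h2 => ?_,
        fun x h1 h2 => ?_⟩
      · have := hno x
        rw [mABC] at this
        have : x ∈ AB := (mAB x).2 (by omega)
        rwa [hp] at this
      · have := hno x
        rw [mABC] at this
        have : x ∈ AC := (mAC x).2 (by omega)
        rwa [hq] at this
      · have := hno x
        rw [mABC] at this
        have : x ∈ BC := (mBC x).2 (by omega)
        rwa [hr] at this
    exact ht.false hcub hN (by omega) (by omega) (by omega)
  · have hAB0 := emp _ h0
    have hAC0 := emp AC (by omega)
    have hBC0 := emp BC (by omega)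
    simp only [mAB] at hAB0
    simp only [mAC] at hAC0
    simp only [mBC] at hBC0
    obtain h1 | h1 : ABC.ncard = 1 ∨ ABC.ncard = 0 := by omega
    · obtain ⟨o, ho⟩ := Set.ncard_eq_one.1 h1
      have mo := (mABC o).1 (by simp [ho])
      have heq : ∀ x, G.dist x a = G.dist x b → G.dist x a = G.dist x c → x = o := by
        intro x h1 h2
        have : x ∈ ABC := ⟨h1, h2⟩
        rwa [ho] at this
      refine (hsplit (by omega) (by omega) (by omega)).false_of_center hN hγ (o := o) (by omega)
        (by omega) (by omega) (fun x h1 h2 => ?_) (fun x h1 h2 => ?_) (fun x h1 h2 => ?_)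
        (by omega) (by omega)
      · have := hAB0 x
        exact heq x (by omega) (by omega)
      · have := hAC0 x
        exact heq x (by omega) (by omega)
      · have := hBC0 x
        exact heq x (by omega) (by omega)
    · have h10 := emp _ h1
      simp only [mABC] at h10
      obtain ⟨x, hx⟩ := Set.ncard_eq_one.1 (show (G.detour a b c a').ncard = 1 by omega)
      obtain ⟨y, hy⟩ := Set.ncard_eq_one.1 (show (G.detour b c a b').ncard = 1 by omega)
      obtain ⟨z, hz⟩ := Set.ncard_eq_one.1 (show (G.detour c a b c').ncard = 1 by omega)
      refine h.false_of_detour_eq_singleton hG (fun x => ?_) (fun x => ?_) (fun x => ?_) hx hy hz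
      · have := hAB0 x
        have := h10 x
        omega
      · have := hAC0 x
        have := h10 x
        omega
      · have := hBC0 x
        have := h10 x
        omega

end IsCubicTriangle

theorem IsNicelyDistanceBalanced.not_triangle [Fintype V] [DecidableRel G.Adj]
    (hcub : G.IsRegularOfDegree 3) {γ : ℕ} (hN : G.IsNicelyDistanceBalanced γ) (hγ : 2 ≤ γ)
    {a b c : V} (hab : G.Adj a b) (hac : G.Adj a c) (hbc : G.Adj b c) : False := by
  obtain ⟨a', ha', ha1, ha2, ha⟩ := exists_third_neighbor hcub hab hac hbc.ne
  obtain ⟨b', hb', hb1, hb2, hb⟩ := exists_third_neighbor hcub hab.symm hbc hac.ne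
  obtain ⟨c', hc', hc1, hc2, hc⟩ := exists_third_neighbor hcub hac.symm hbc.symm hab.ne
  exact IsCubicTriangle.false_of_two_le hcub hN hγ
    ⟨hab, hac, hbc, ha', hb', hc', ha1, ha2, hb1, hb2, hc1, hc2, ha, hb, hc⟩

/-! ### Geodesics of maximal length and diameter at least five -/

/-- The vertices `x 0`, ..., `x d` form a geodesic of length `d`; the other values of `x` are
irrelevant. -/
structure IsGeodesic (G : SimpleGraph V) (x : ℕ → V) (d : ℕ) : Prop where
  adj : ∀ i < d, G.Adj (x i) (x (i + 1))
  dist_eq : G.dist (x 0) (x d) = d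

theorem Connected.exists_isGeodesic (hG : G.Connected) (u w : V) :
    ∃ x : ℕ → V, G.IsGeodesic x (G.dist u w) ∧ x 0 = u ∧ x (G.dist u w) = w := by
  obtain ⟨p, hp⟩ := hG.exists_walk_length_eq_dist u w
  have h0 : p.getVert 0 = u := p.getVert_zero
  have h1 : p.getVert (G.dist u w) = w := by rw [← hp]; exact p.getVert_length
  refine ⟨p.getVert, ⟨fun i hi => p.adj_getVert_succ (by omega), ?_⟩, h0, h1⟩
  rw [h0, h1]

namespace IsGeodesic

variable {x : ℕ → V} {d : ℕ}

theorem dist_add (hG : G.Connected) (hx : G.IsGeodesic x d) {i j : ℕ} (hij : i ≤ j) (hj : j ≤ d) :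
    G.dist (x i) (x j) + i = j := by
  have upper : ∀ i j, i ≤ j → j ≤ d → G.dist (x i) (x j) + i ≤ j := by
    intro i j hij
    induction j, hij using Nat.le_induction with
    | base => simp
    | succ j _ ih =>
      intro hj
      have h1 := ih (by omega)
      have h2 := hG.dist_le_dist_add_one' (hx.adj j (by omega)).symm (x i)
      omega
  have h1 := upper 0 i (by omega) (by omega)
  have h2 := upper i j hij hj
  have h3 := upper j d hj le_rfl
  have h4 := hG.dist_triangle (u := x 0) (v := x i) (w := x d)
  have h5 := hG.dist_triangle (u := x i) (v := x j) (w := x d)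
  have h6 := hx.dist_eq
  omega

theorem reverse (hx : G.IsGeodesic x d) : G.IsGeodesic (fun i => x (d - i)) d := by
  refine ⟨fun i hi => ?_, ?_⟩
  · have := (hx.adj (d - (i + 1)) (by omega)).symm
    rwa [show d - (i + 1) + 1 = d - i by omega] at this
  · simp only [Nat.sub_zero, Nat.sub_self]
    rw [dist_comm, hx.dist_eq]

theorem eq_of_eq (hG : G.Connected) (hx : G.IsGeodesic x d) {i j : ℕ} (hi : i ≤ d) (hj : j ≤ d)
    (h : x i = x j) : i = j := by
  rcases le_total i j with hij | hij
  · have := hx.dist_add hG hij hj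
    rw [h, dist_self] at this
    omega
  · have := hx.dist_add hG hij hi
    rw [h, dist_self] at this
    omega

end IsGeodesic

/-- The graphs to be classified, once triangles are excluded: connected triangle-free cubic graphs
of diameter at most `d` with `d + 1` vertices closer to either end of each edge. -/
structure IsTightCubic (G : SimpleGraph V) (d : ℕ) : Prop where
  finite : Finite V
  conn : G.Connected
  exists_adj : ∀ a, ∃ b, G.Adj a b
  exists_nbrs : ∀ {a u : V}, G.Adj a u → ∃ v w, G.Adj a v ∧ G.Adj a w ∧ v ≠ u ∧ w ≠ u ∧ w ≠ v ∧
    ∀ y, G.Adj a y → y = u ∨ y = v ∨ y = w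
  exists_third : ∀ {a u v : V}, G.Adj a u → G.Adj a v → u ≠ v →
    ∃ z, G.Adj a z ∧ z ≠ u ∧ z ≠ v ∧ ∀ y, G.Adj a y → y = u ∨ y = v ∨ y = z
  not_triangle : ∀ {a b c : V}, G.Adj a b → G.Adj a c → G.Adj b c → False
  dist_le : ∀ u v, G.dist u v ≤ d
  ncard_eq : ∀ {u v : V}, G.Adj u v → {x | G.dist x u < G.dist x v}.ncard = d + 1

namespace IsTightCubic

variable {x : ℕ → V} {d : ℕ}

theorem card_le (h : G.IsTightCubic d) {u v : V} (huv : G.Adj u v) {s : Finset V}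
    (hs : ∀ y ∈ s, G.dist y u < G.dist y v) : s.card ≤ d + 1 := by
  have := h.finite
  rw [← h.ncard_eq huv, ← Set.ncard_coe_finset]
  exact Set.ncard_le_ncard hs (Set.toFinite _)

theorem mem_of_card (h : G.IsTightCubic d) {u v : V} (huv : G.Adj u v) {s : Finset V}
    (hs : ∀ y ∈ s, G.dist y u < G.dist y v) (hcard : d + 1 ≤ s.card) {y : V}
    (hy : G.dist y u < G.dist y v) : y ∈ s := by
  classical
  by_contra hys
  have := h.card_le huv (s := insert y s) (by
    intro t ht
    rcases Finset.mem_insert.1 ht with rfl | ht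
    · exact hy
    · exact hs t ht)
  rw [Finset.card_insert_of_notMem hys] at this
  omega

/-- The vertices closer to the second vertex `x 1` of a geodesic of length `d` than to the first one
are `x 1`, ..., `x d` and the neighbor of `x 1` off the geodesic. -/
theorem eq_of_dist_lt (h : G.IsTightCubic d) (hd : 2 ≤ d) (hx : G.IsGeodesic x d) {z : V}
    (hz : G.Adj (x 1) z) (hz0 : z ≠ x 0) (hz2 : z ≠ x 2) {y : V}
    (hy : G.dist y (x 1) < G.dist y (x 0)) : y = z ∨ ∃ i, 1 ≤ i ∧ i ≤ d ∧ y = x i := by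
  classical
  have hG := h.conn
  have hinj : Set.InjOn x (Finset.Icc 1 d : Finset ℕ) := by
    intro i hi j hj hij
    simp only [Finset.coe_Icc, Set.mem_Icc] at hi hj
    exact hx.eq_of_eq hG hi.2 hj.2 hij
  have h01 : G.Adj (x 0) (x 1) := hx.adj 0 (by omega)
  have hzmem : z ∉ (Finset.Icc 1 d).image x := by
    simp only [Finset.mem_image, Finset.mem_Icc, not_exists, not_and]
    rintro i ⟨hi1, hi2⟩ rfl
    have h1 := hx.dist_add hG hi1 hi2
    rw [dist_eq_one_iff_adj.2 hz] at h1
    exact hz2 (by rw [← h1])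
  have hmem := h.mem_of_card h01.symm (s := insert z ((Finset.Icc 1 d).image x)) (by
    intro t ht
    simp only [Finset.mem_insert, Finset.mem_image, Finset.mem_Icc] at ht
    rcases ht with rfl | ⟨i, ⟨hi1, hi2⟩, rfl⟩
    · rw [dist_eq_one_iff_adj.2 hz.symm]
      have e1 : G.dist t (x 0) ≠ 0 := fun e => hz0 (hG.dist_eq_zero_iff.1 e)
      have e2 : G.dist t (x 0) ≠ 1 := fun e =>
        h.not_triangle h01.symm hz (dist_eq_one_iff_adj.1 e).symm
      omega
    · rw [dist_comm, dist_comm (v := x 0)]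
      have h1 := hx.dist_add hG hi1 hi2
      have h2 := hx.dist_add hG (Nat.zero_le i) hi2
      omega) (by
    rw [Finset.card_insert_of_notMem hzmem, Finset.card_image_of_injOn hinj]
    simp) hy
  simp only [Finset.mem_insert, Finset.mem_image, Finset.mem_Icc] at hmem
  rcases hmem with rfl | ⟨i, ⟨hi1, hi2⟩, rfl⟩
  · exact Or.inl rfl
  · exact Or.inr ⟨i, hi1, hi2, rfl⟩

/-- The neighbor of `x 2` off a geodesic is not closer to `x 1` than to `x 0`. -/
theorem dist_le_of_adj_two (h : G.IsTightCubic d) (hd : 3 ≤ d) (hx : G.IsGeodesic x d) {y : V}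
    (hy : G.Adj (x 2) y) (hy1 : y ≠ x 1) (hy3 : y ≠ x 3) :
    G.dist y (x 0) ≤ G.dist y (x 1) := by
  have hG := h.conn
  by_contra! hlt
  have h01 : G.Adj (x 0) (x 1) := hx.adj 0 (by omega)
  have h12 : G.Adj (x 1) (x 2) := hx.adj 1 (by omega)
  have h02 : x 0 ≠ x 2 := fun e => by have := hx.eq_of_eq hG (by omega) (by omega) e; omega
  obtain ⟨z, hz, hz0, hz2, -⟩ := h.exists_third h01.symm h12 h02
  rcases h.eq_of_dist_lt (by omega) hx hz hz0 hz2 hlt with rfl | ⟨i, hi1, hi2, rfl⟩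
  · exact h.not_triangle h12 hz hy
  · rcases Nat.lt_or_ge i 2 with hi | hi
    · exact hy1 (by rw [show i = 1 by omega])
    · have := hx.dist_add hG hi hi2
      rw [dist_eq_one_iff_adj.2 hy] at this
      exact hy3 (by rw [show i = 3 by omega])

/-- The diameter is at most four. If `y` is the neighbor of `x 2` off a geodesic of length
`d ≥ 5`, then `y` is at distance `2` from `x 0` and `d - 2` from `x d`, and the next two vertices of a
geodesic from `y` to `x d` are closer to `x 2` than to `x 1`, as are `y` and `x 2`, ..., `x d`. These
are too many. -/
theorem false_of_five_le (h : G.IsTightCubic d) (hd : 5 ≤ d) (hx : G.IsGeodesic x d) : False := by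
  classical
  have hG := h.conn
  have D : ∀ i j, i ≤ j → j ≤ d → G.dist (x i) (x j) + i = j := fun i j => hx.dist_add hG
  have h01 : G.Adj (x 0) (x 1) := hx.adj 0 (by omega)
  have h12 : G.Adj (x 1) (x 2) := hx.adj 1 (by omega)
  have h23 : G.Adj (x 2) (x 3) := hx.adj 2 (by omega)
  have h02 : x 0 ≠ x 2 := fun e => by have := hx.eq_of_eq hG (by omega) (by omega) e; omega
  have h13 : x 1 ≠ x 3 := fun e => by have := hx.eq_of_eq hG (by omega) (by omega) e; omega
  obtain ⟨z, hz, hz0, hz2, -⟩ := h.exists_third h01.symm h12 h02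
  obtain ⟨y, hy, hy1, hy3, -⟩ := h.exists_third h12.symm h23 h13
  have hyu := h.dist_le_of_adj_two (by omega) hx hy hy1 hy3
  have d21 : G.dist (x 2) (x 1) = 1 := dist_eq_one_iff_adj.2 h12.symm
  have y1 := hG.dist_le_dist_add_one hy.symm (x 1)
  -- The same holds at the other end of the geodesic.
  have hyw : G.dist y (x d) ≤ G.dist y (x (d - 1)) := by
    by_contra! hlt
    have e1 : G.Adj (x (d - 1)) (x d) := by
      have := hx.adj (d - 1) (by omega)
      rwa [show d - 1 + 1 = d by omega] at this
    have e2 : G.Adj (x (d - 2)) (x (d - 1)) := by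
      have := hx.adj (d - 2) (by omega)
      rwa [show d - 2 + 1 = d - 1 by omega] at this
    have e3 : x d ≠ x (d - 2) := fun e => by
      have := hx.eq_of_eq hG (by omega) (by omega) e; omega
    obtain ⟨t, ht, ht0, ht2, -⟩ := h.exists_third e1 e2.symm e3
    rcases h.eq_of_dist_lt (by omega) hx.reverse ht ht0 ht2 hlt with rfl | ⟨i, hi1, hi2, hi⟩
    · have := hG.dist_le_dist_add_one ht (x 0)
      have := D 0 (d - 1) (by omega) (by omega)
      rw [dist_comm] at this
      omega
    · have h2 : G.dist (x 2) (x (d - i)) = 1 := by rw [← hi]; exact dist_eq_one_iff_adj.2 hy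
      rcases Nat.lt_or_ge (d - i) 2 with hlt2 | hge
      · have := D (d - i) 2 (by omega) (by omega)
        rw [dist_comm] at this
        exact hy1 (by rw [hi, show d - i = 1 by omega])
      · have := D 2 (d - i) hge (by omega)
        exact hy3 (by rw [hi, show d - i = 3 by omega])
  have w1 := hG.dist_le_dist_add_one hy.symm (x (d - 1))
  have w2 := D 2 (d - 1) (by omega) (by omega)
  have w3 := D 0 d (by omega) le_rfl
  have w4 := hG.dist_triangle (u := x 0) (v := y) (w := x d)
  rw [dist_comm (u := x 0) (v := y)] at w4
  have hne : ∀ {t : V}, 0 < G.dist t (x d) → t ≠ x d := by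
    rintro _ ht rfl
    rw [dist_self] at ht
    omega
  obtain ⟨y', hyy', hy'd⟩ := hG.exists_adj_dist_eq (hne (show 0 < G.dist y (x d) by omega))
  obtain ⟨y'', hyy'', hy''d⟩ := hG.exists_adj_dist_eq (hne (show 0 < G.dist y' (x d) by omega))
  have a1 := hG.dist_triangle (u := x 0) (v := y') (w := x d)
  have a2 := hG.dist_triangle (u := x 0) (v := y'') (w := x d)
  have a3 := hG.dist_le_dist_add_one hyy'.symm (x 0)
  have a4 := hG.dist_le_dist_add_one hyy''.symm (x 0)
  rw [dist_comm (u := x 0) (v := y')] at a1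
  rw [dist_comm (u := x 0) (v := y'')] at a2
  have z0 := hG.dist_le_dist_add_one hz.symm (x 0)
  have d10 : G.dist (x 1) (x 0) = 1 := dist_eq_one_iff_adj.2 h01.symm
  -- `y'` and `y''` are not closer to `x 1` than to `x 0`, since they avoid the geodesic.
  have b1 : G.dist y' (x 0) ≤ G.dist y' (x 1) := by
    by_contra! hlt
    rcases h.eq_of_dist_lt (by omega) hx hz hz0 hz2 hlt with rfl | ⟨i, hi1, hi2, rfl⟩
    · omega
    · have := D 0 i (by omega) hi2
      rw [dist_comm] at this
      have hi3 : i = 3 := by omega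
      subst hi3
      exact h.not_triangle hy h23 hyy'
  have b2 : G.dist y'' (x 0) ≤ G.dist y'' (x 1) := by
    by_contra! hlt
    rcases h.eq_of_dist_lt (by omega) hx hz hz0 hz2 hlt with rfl | ⟨i, hi1, hi2, rfl⟩
    · omega
    · have := D 0 i (by omega) hi2
      rw [dist_comm] at this
      have hi3 : i = 4 := by omega
      subst hi3
      have c1 := D 4 (d - 1) (by omega) (by omega)
      have c2 := hG.dist_le_dist_add_one hyy'' (x (d - 1))
      have c3 := hG.dist_le_dist_add_one hyy' (x (d - 1))
      omega
  have c1 : G.dist y (x 2) = 1 := dist_eq_one_iff_adj.2 hy.symm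
  have c2 := hG.dist_le_dist_add_one hyy'.symm (x 2)
  have c3 := hG.dist_le_dist_add_one hyy''.symm (x 2)
  have hinj : Set.InjOn x (Finset.Icc 2 d : Finset ℕ) := by
    intro i hi j hj hij
    simp only [Finset.coe_Icc, Set.mem_Icc] at hi hj
    exact hx.eq_of_eq hG hi.2 hj.2 hij
  -- The vertices of the geodesic, in contrast, lie closer to `x 1` than to `x 0`.
  have off : ∀ t, G.dist t (x 0) ≤ G.dist t (x 1) → t ∉ (Finset.Icc 2 d).image x := by
    intro t ht hmem
    simp only [Finset.mem_image, Finset.mem_Icc] at hmem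
    obtain ⟨i, ⟨hi1, hi2⟩, rfl⟩ := hmem
    have e1 := D 0 i (by omega) hi2
    have e2 := D 1 i (by omega) hi2
    rw [dist_comm] at e1 e2
    omega
  have hcard := h.card_le h12.symm (s := insert y (insert y' (insert y''
      ((Finset.Icc 2 d).image x)))) (by
    intro t ht
    simp only [Finset.mem_insert, Finset.mem_image, Finset.mem_Icc] at ht
    rcases ht with rfl | rfl | rfl | ⟨i, ⟨hi1, hi2⟩, rfl⟩
    · omega
    · omega
    · omega
    · have e1 := D 1 i (by omega) hi2
      have e2 := D 2 i (by omega) hi2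
      rw [dist_comm] at e1 e2
      omega)
  have n1 : y ≠ y'' := by rintro rfl; omega
  rw [Finset.card_insert_of_notMem, Finset.card_insert_of_notMem, Finset.card_insert_of_notMem,
    Finset.card_image_of_injOn hinj, Nat.card_Icc] at hcard
  · omega
  · exact off _ b2
  · rw [Finset.mem_insert]
    exact fun e => e.elim hyy''.ne (off _ b1)
  · rw [Finset.mem_insert, Finset.mem_insert]
    exact fun e => e.elim hyy'.ne fun e => e.elim n1 (off _ hyu)

end IsTightCubic

/-! ### Geodesics of length four -/

/-- The vertices `a`, `b`, `c`, `e`, `f` form a geodesic of length four. -/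
structure IsGeodesicFour (G : SimpleGraph V) (a b c e f : V) : Prop where
  ab : G.Adj a b
  bc : G.Adj b c
  ce : G.Adj c e
  ef : G.Adj e f
  dist_eq : G.dist a f = 4

namespace IsGeodesicFour

variable {a b c e f : V}

theorem reverse (h : G.IsGeodesicFour a b c e f) : G.IsGeodesicFour f e c b a :=
  ⟨h.ef.symm, h.ce.symm, h.bc.symm, h.ab.symm, by rw [dist_comm]; exact h.dist_eq⟩

theorem dists (hG : G.Connected) (h : G.IsGeodesicFour a b c e f) :
    G.dist a c = 2 ∧ G.dist a e = 3 ∧ G.dist b e = 2 ∧ G.dist b f = 3 ∧ G.dist c f = 2 := by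
  have h1 := h.dist_eq
  have h2 := hG.dist_le_dist_add_one h.ab f
  have h3 := hG.dist_le_dist_add_one h.bc f
  have h4 := hG.dist_le_dist_add_one h.ce f
  have h5 : G.dist e f = 1 := dist_eq_one_iff_adj.2 h.ef
  have h6 := hG.dist_le_dist_add_one' h.ef.symm a
  have h7 := hG.dist_le_dist_add_one' h.ce.symm a
  have h8 := hG.dist_le_dist_add_one' h.bc.symm a
  have h9 : G.dist a b = 1 := dist_eq_one_iff_adj.2 h.ab
  have h10 := hG.dist_triangle (u := b) (v := e) (w := f)
  have h11 := hG.dist_le_dist_add_one' h.ce.symm b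
  have h12 : G.dist b c = 1 := dist_eq_one_iff_adj.2 h.bc
  omega

end IsGeodesicFour

namespace IsTightCubic

variable {a b c e f z y y' : V}

/-- `IsTightCubic.eq_of_dist_lt` for a geodesic of length four with named vertices. -/
theorem eq_of_dist_lt_four (h : G.IsTightCubic 4) (hp : G.IsGeodesicFour a b c e f)
    (hz : G.Adj b z) (hza : z ≠ a) (hzc : z ≠ c) {t : V} (ht : G.dist t b < G.dist t a) :
    t = z ∨ t = b ∨ t = c ∨ t = e ∨ t = f := by
  let x : ℕ → V
    | 0 => a
    | 1 => b
    | 2 => c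
    | 3 => e
    | _ => f
  have hx : G.IsGeodesic x 4 := by
    refine ⟨fun i hi => ?_, hp.dist_eq⟩
    interval_cases i
    exacts [hp.ab, hp.bc, hp.ce, hp.ef]
  rcases h.eq_of_dist_lt (by norm_num) hx hz hza hzc ht with rfl | ⟨i, hi1, hi2, rfl⟩
  · exact Or.inl rfl
  · interval_cases i <;> simp [x]

/-- The neighbor of the middle vertex of a geodesic of length four off the geodesic is not closer to
`b` than to `a`; by symmetry, it is at distance two from all other vertices of the geodesic. -/
theorem dist_le_of_adj_mid (h : G.IsTightCubic 4) (hp : G.IsGeodesicFour a b c e f)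
    (hy : G.Adj c y) (hyb : y ≠ b) (hye : y ≠ e) : G.dist y a ≤ G.dist y b := by
  obtain ⟨ac, ae, be, bf, cf⟩ := hp.dists h.conn
  by_contra! hlt
  have hac : a ≠ c := by rintro rfl; simp at ac
  obtain ⟨z, hz, hza, hzc, -⟩ := h.exists_third hp.ab.symm hp.bc hac
  rcases h.eq_of_dist_lt_four hp hz hza hzc hlt with rfl | rfl | rfl | rfl | rfl
  · exact h.not_triangle hp.bc hz hy
  · exact hyb rfl
  · exact hy.ne rfl
  · exact hye rfl
  · rw [dist_eq_one_iff_adj.2 hy] at cf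
    omega

theorem dists_of_adj_mid (h : G.IsTightCubic 4) (hp : G.IsGeodesicFour a b c e f)
    (hy : G.Adj c y) (hyb : y ≠ b) (hye : y ≠ e) :
    G.dist y a = 2 ∧ G.dist y b = 2 ∧ G.dist y e = 2 ∧ G.dist y f = 2 := by
  have h1 := h.dist_le_of_adj_mid hp hy hyb hye
  have h2 := h.dist_le_of_adj_mid hp.reverse hy hye hyb
  have h3 := h.conn.dist_le_dist_add_one hy.symm b
  have h4 := h.conn.dist_le_dist_add_one hy.symm e
  rw [dist_eq_one_iff_adj.2 hp.bc.symm] at h3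
  rw [dist_eq_one_iff_adj.2 hp.ce] at h4
  have h5 := h.conn.dist_triangle (u := a) (v := y) (w := f)
  rw [hp.dist_eq, dist_comm] at h5
  omega

theorem not_adj_mid (h : G.IsTightCubic 4) (hp : G.IsGeodesicFour a b c e f)
    (hyy' : G.Adj y y') (hy' : G.Adj y' f) (hy : G.Adj c y) (hyb : y ≠ b) (hye : y ≠ e) :
    y' ≠ e ∧ 3 ≤ G.dist y' a ∧ 3 ≤ G.dist y' b := by
  have hG := h.conn
  obtain ⟨ac, ae, be, bf, cf⟩ := hp.dists hG
  have hye' : y' ≠ e := by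
    rintro rfl
    exact h.not_triangle hy hp.ce hyy'
  have h1 : 3 ≤ G.dist y' a := by
    have := hG.dist_le_dist_add_one hy'.symm a
    rw [dist_comm, hp.dist_eq] at this
    omega
  refine ⟨hye', h1, ?_⟩
  by_contra! hlt
  have hac : a ≠ c := by rintro rfl; simp at ac
  obtain ⟨z, hz, hza, hzc, -⟩ := h.exists_third hp.ab.symm hp.bc hac
  rcases h.eq_of_dist_lt_four hp hz hza hzc (show G.dist y' b < G.dist y' a by omega)
    with rfl | rfl | rfl | rfl | rfl
  · have := hG.dist_le_dist_add_one hz.symm a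
    rw [dist_eq_one_iff_adj.2 hp.ab.symm] at this
    omega
  · rw [dist_eq_one_iff_adj.2 hp.ab.symm] at h1
    omega
  · rw [dist_comm] at ac; omega
  · exact hye' rfl
  · exact hy'.ne rfl

/-- A geodesic of length four and another one from its middle vertex through `y` account for all
vertices closer to the middle vertex `c` than to `b`. -/
theorem eq_of_dist_lt_mid (h : G.IsTightCubic 4) (hp : G.IsGeodesicFour a b c e f)
    (hyy' : G.Adj y y') (hy' : G.Adj y' f) (hy : G.Adj c y) (hyb : y ≠ b) (hye : y ≠ e) {t : V}
    (ht : G.dist t c < G.dist t b) : t = c ∨ t = e ∨ t = f ∨ t = y ∨ t = y' := by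
  classical
  have hG := h.conn
  obtain ⟨ac, ae, be, bf, cf⟩ := hp.dists hG
  obtain ⟨h1, h2, h3⟩ := h.not_adj_mid hp hyy' hy' hy hyb hye
  obtain ⟨e1, e2, e3, e4⟩ := h.dists_of_adj_mid hp hy hyb hye
  have cy' := hG.dist_le_dist_add_one hyy'.symm c
  rw [dist_eq_one_iff_adj.2 hy.symm] at cy'
  have hyf : y ≠ f := by rintro rfl; simp at e4
  have hcf : c ≠ f := by rintro rfl; simp at cf
  have hcy' : c ≠ y' := by
    rintro rfl
    rw [dist_eq_one_iff_adj.2 hp.bc.symm] at h3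
    omega
  have := h.mem_of_card hp.bc.symm (s := {c, e, f, y, y'}) (by
    intro t ht
    simp only [Finset.mem_insert, Finset.mem_singleton] at ht
    rcases ht with rfl | rfl | rfl | rfl | rfl
    · rw [dist_self]; exact hG.pos_dist_of_ne hp.bc.ne'
    · rw [dist_comm, dist_eq_one_iff_adj.2 hp.ce, dist_comm, be]
      norm_num
    · rw [dist_comm, cf, dist_comm, bf]
      norm_num
    · rw [dist_eq_one_iff_adj.2 hy.symm, e2]
      norm_num
    · omega) (by
    rw [Finset.card_insert_of_notMem, Finset.card_insert_of_notMem, Finset.card_insert_of_notMem,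
      Finset.card_insert_of_notMem, Finset.card_singleton]
    · simpa using hyy'.ne
    · simpa using ⟨hyf.symm, hy'.ne'⟩
    · simpa using ⟨hp.ef.ne, hye.symm, h1.symm⟩
    · simpa using ⟨hp.ce.ne, hcf, hy.ne, hcy'⟩) ht
  simpa using this

theorem exists_of_dist_eq_two {d : ℕ} (h : G.IsTightCubic d) (hy : G.dist y f = 2) :
    ∃ t, G.Adj y t ∧ G.Adj t f := by
  have hne : y ≠ f := by rintro rfl; simp at hy
  obtain ⟨t, hyt, ht⟩ := h.conn.exists_adj_dist_eq hne
  exact ⟨t, hyt, dist_eq_one_iff_adj.1 (by omega)⟩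

/-- The second and fourth vertex of a geodesic of length four have both neighbors other than the
ends of the geodesic in common. -/
theorem adj_of_adj_second (h : G.IsTightCubic 4) (hp : G.IsGeodesicFour a b c e f)
    (hz : G.Adj b z) (hza : z ≠ a) (hzc : z ≠ c) : G.Adj z e := by
  have hG := h.conn
  obtain ⟨ac, ae, be, bf, cf⟩ := hp.dists hG
  by_contra hze
  have hac : a ≠ c := by rintro rfl; simp at ac
  have hbe : b ≠ e := by rintro rfl; simp at be
  have hcf : c ≠ f := by rintro rfl; simp at cf
  obtain ⟨y, hy, hyb, hye, -⟩ := h.exists_third hp.bc.symm hp.ce hbe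
  obtain ⟨e1, e2, e3, e4⟩ := h.dists_of_adj_mid hp hy hyb hye
  obtain ⟨y', hyy', hy'⟩ := h.exists_of_dist_eq_two e4
  obtain ⟨w, hw, hwc, hwf, -⟩ := h.exists_third hp.ce.symm hp.ef hcf
  have wa : 2 ≤ G.dist w a := by
    have := hG.dist_le_dist_add_one hw a
    rw [dist_comm, ae] at this
    omega
  have wb0 := hG.dist_le_dist_add_one hw b
  rw [dist_comm, be] at wb0
  have wc := hG.dist_le_dist_add_one hw.symm c
  rw [dist_eq_one_iff_adj.2 hp.ce.symm] at wc
  have wb : G.dist w b ≤ G.dist w c := by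
    by_contra! hlt
    rcases h.eq_of_dist_lt_mid hp hyy' hy' hy hyb hye hlt with rfl | rfl | rfl | rfl | rfl
    · exact hwc rfl
    · exact hw.ne rfl
    · exact hwf rfl
    · exact h.not_triangle hp.ce hy hw
    · exact h.not_triangle hp.ef hw hy'.symm
  obtain ⟨s, hbs, hs⟩ := hG.exists_adj_dist_eq (show b ≠ w by rintro rfl; simp at wb0)
  rw [dist_comm (v := w)] at hs
  obtain ⟨z₀, hz₀, hz₀a, hz₀c, hnb⟩ := h.exists_third hp.ab.symm hp.bc hac
  have hzz₀ : z = z₀ := by have := hnb z hz; tauto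
  subst hzz₀
  rcases hnb s hbs with rfl | rfl | rfl
  · rw [dist_comm] at wa
    omega
  · by_cases hsw : G.dist s w = 0
    · exact hwc (hG.dist_eq_zero_iff.1 hsw).symm
    · exact h.not_triangle hp.ce (dist_eq_one_iff_adj.1 (by omega)) hw
  have hsw : s ≠ w := by rintro rfl; exact hze hw.symm
  have hsw' : G.Adj s w := dist_eq_one_iff_adj.1 (by
    have := hG.pos_dist_of_ne hsw
    omega)
  have wa2 : G.dist w a ≤ 2 := by
    by_contra! hlt
    rcases h.eq_of_dist_lt_four hp hz hza hzc (t := w) (by omega) with rfl | rfl | rfl | rfl | rfl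
    · exact hsw rfl
    · rw [dist_eq_one_iff_adj.2 hp.ab.symm] at wa
      omega
    · exact hwc rfl
    · exact hw.ne rfl
    · exact hwf rfl
  obtain ⟨k, hwk, hka⟩ := h.exists_of_dist_eq_two (show G.dist w a = 2 by omega)
  have ke := hG.dist_le_dist_add_one hwk.symm e
  rw [dist_eq_one_iff_adj.2 hw.symm] at ke
  have kf := hG.dist_le_dist_add_one hka.symm f
  rw [hp.dist_eq] at kf
  rcases h.eq_of_dist_lt_four hp.reverse hw hwf hwc (t := k) (by omega)
    with rfl | rfl | rfl | rfl | rfl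
  · exact hwk.ne rfl
  · rw [dist_comm, dist_eq_one_iff_adj.2 hka] at ae
    omega
  · rw [dist_comm, dist_eq_one_iff_adj.2 hka] at ac
    omega
  · exact h.not_triangle hz hwk.symm hsw'
  · exact hka.ne rfl

end IsTightCubic

/-! ### Diameter four -/

namespace IsTightCubic

variable {a b c e f z y y' t w : V}

theorem exists_of_dist_le_three {d : ℕ} (h : G.IsTightCubic d) {u v : V} (hd : G.dist u v ≤ 3)
    (huv : u ≠ v) (hadj : ¬ G.Adj u v) :
    ∃ s s', G.Adj u s ∧ G.Adj v s' ∧ (s = s' ∨ G.Adj s s') := by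
  obtain ⟨s, hus, hs⟩ := h.conn.exists_adj_dist_eq huv
  have hvs : v ≠ s := by rintro rfl; exact hadj hus
  obtain ⟨s', hvs', hs'⟩ := h.conn.exists_adj_dist_eq hvs
  rw [dist_comm] at hs'
  refine ⟨s, s', hus, hvs', ?_⟩
  by_cases he : s = s'
  · exact Or.inl he
  · have := h.conn.pos_dist_of_ne (Ne.symm he)
    exact Or.inr (dist_eq_one_iff_adj.1 (by omega)).symm

theorem not_four_adj {d : ℕ} (h : G.IsTightCubic d) {u v₁ v₂ v₃ v₄ : V} (h₁ : G.Adj u v₁)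
    (h₂ : G.Adj u v₂) (h₃ : G.Adj u v₃) (h₄ : G.Adj u v₄) (h₁₂ : v₁ ≠ v₂) (h₁₃ : v₁ ≠ v₃)
    (h₁₄ : v₁ ≠ v₄) (h₂₃ : v₂ ≠ v₃) (h₂₄ : v₂ ≠ v₄) (h₃₄ : v₃ ≠ v₄) : False := by
  obtain ⟨x, -, -, -, hx⟩ := h.exists_third h₁ h₂ h₁₂
  have := hx _ h₃
  have := hx _ h₄
  grind

/-- In diameter four, the neighbor `t` of `f` off two geodesics from `a` to `f` is adjacent to the
vertex that hangs at the fourth vertex `z` of the square on `b`, `c`, `e`. -/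
theorem adj_of_adj_end (h : G.IsTightCubic 4) (hp : G.IsGeodesicFour a b c e f)
    (hyy' : G.Adj y y') (hy' : G.Adj y' f) (hy : G.Adj c y) (hyb : y ≠ b) (hye : y ≠ e)
    (ht : G.Adj f t) (hte : t ≠ e) (hty' : t ≠ y') (hz : G.Adj b z) (hza : z ≠ a) (hzc : z ≠ c)
    (hw : G.Adj z w) (hwb : w ≠ b) (hwe : w ≠ e) : G.Adj t w := by
  have hG := h.conn
  obtain ⟨ac, ae, be, bf, cf⟩ := hp.dists hG
  obtain ⟨ya, yb, ye, yf⟩ := h.dists_of_adj_mid hp hy hyb hye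
  obtain ⟨n1, n2, n3⟩ := h.not_adj_mid hp hyy' hy' hy hyb hye
  have hze := h.adj_of_adj_second hp hz hza hzc
  have hac : a ≠ c := by rintro rfl; simp at ac
  have hbe : b ≠ e := by rintro rfl; simp at be
  obtain ⟨k, hyk, hka⟩ := h.exists_of_dist_eq_two ya
  have ak : G.dist k a = 1 := dist_eq_one_iff_adj.2 hka
  have tf : G.dist t f = 1 := dist_eq_one_iff_adj.2 ht.symm
  have ta := hG.dist_le_dist_add_one ht a
  rw [dist_comm, hp.dist_eq] at ta
  have tb := hG.dist_le_dist_add_one ht b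
  rw [dist_comm, bf] at tb
  have htc : t ≠ c := by rintro rfl; omega
  have hty : t ≠ y := by rintro rfl; omega
  have hNb : ∀ s, G.Adj b s → s = a ∨ s = c ∨ s = z := by
    obtain ⟨s, hs, hsa, hsc, hN⟩ := h.exists_third hp.ab.symm hp.bc hac
    have := hN z hz
    have : z = s := by tauto
    rwa [this]
  have hNc : ∀ s, G.Adj c s → s = b ∨ s = e ∨ s = y := by
    obtain ⟨s, hs, hsa, hsc, hN⟩ := h.exists_third hp.bc.symm hp.ce hbe
    have := hN y hy
    have : y = s := by tauto
    rwa [this]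
  have hNz : ∀ s, G.Adj z s → s = b ∨ s = e ∨ s = w := by
    obtain ⟨s, hs, hsa, hsc, hN⟩ := h.exists_third hz.symm hze hbe
    have := hN w hw
    have : w = s := by tauto
    rwa [this]
  have hte' : ¬ G.Adj t e := fun e' => h.not_triangle hp.ef e'.symm ht
  have hty'' : ¬ G.Adj t y := by
    intro hadj
    refine h.not_four_adj hy.symm hyy' hyk hadj.symm ?_ ?_ htc.symm ?_ hty'.symm ?_
    · rintro rfl; rw [dist_comm] at n2; omega
    · rintro rfl; rw [dist_comm] at ac; omega
    · rintro rfl; omega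
    · rintro rfl; omega
  have far : ∀ {s}, G.dist t s ≤ 1 → t ≠ s → G.Adj t s := fun hs hne =>
    dist_eq_one_iff_adj.1 (by have := hG.pos_dist_of_ne hne; omega)
  have htc3 : 3 ≤ G.dist t c := by
    by_contra! hlt
    obtain ⟨s, hs, hd⟩ := hG.exists_adj_dist_eq htc.symm
    rw [dist_comm, dist_comm (v := t)] at hd
    rcases hNc s hs with rfl | rfl | rfl
    · omega
    · exact hte' (far (by omega) hte)
    · exact hty'' (far (by omega) hty)
  have htc' := hG.dist_triangle (u := t) (v := f) (w := c)
  rw [tf, dist_comm (u := f), cf] at htc'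
  have htb : G.dist t b ≤ G.dist t c := by
    by_contra! hlt
    rcases h.eq_of_dist_lt_mid hp hyy' hy' hy hyb hye hlt with e' | e' | e' | e' | e'
    · exact htc e'
    · exact hte e'
    · exact ht.ne' e'
    · exact hty e'
    · exact hty' e'
  obtain ⟨s, hs, hd⟩ := hG.exists_adj_dist_eq (show b ≠ t by rintro rfl; simp at tb)
  rw [dist_comm, dist_comm (v := t)] at hd
  rcases hNb s hs with rfl | rfl | rfl
  · omega
  · omega
  have hts : t ≠ s := by
    rintro rfl
    rw [dist_eq_one_iff_adj.2 hs.symm] at tb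
    omega
  obtain ⟨q, hq, hd'⟩ := hG.exists_adj_dist_eq hts.symm
  rw [dist_comm, dist_comm (v := t)] at hd'
  rcases hNz q hq with rfl | rfl | rfl
  · omega
  · exact absurd (far (by omega) hte) hte'
  · refine far (by omega) ?_
    rintro rfl
    have h1 : G.dist t s = 1 := dist_eq_one_iff_adj.2 hq.symm
    rcases h.eq_of_dist_lt_four hp hz hza hzc (t := t) (by omega) with e' | e' | e' | e' | e'
    · exact hts e'
    · exact hwb e'
    · exact htc e'
    · exact hte e'
    · exact ht.ne' e'

/-- The diameter is not four. Let `a b c e f` and `a k y y' f` be geodesics with `c` adjacent to `y`,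
and complete `b c e` and `k y y'` to squares by `z` and `ζ`. The neighbors `w` of `z` and `v` of `ζ`
outside of the squares are both adjacent to the remaining neighbors `t` of `a` and `s` of `f`. Then
`w t a k y` is a geodesic, and its square makes `v` a fourth neighbor of `k`. -/
theorem false_of_geodesicFour (h : G.IsTightCubic 4) (hp : G.IsGeodesicFour a b c e f) :
    False := by
  have hG := h.conn
  obtain ⟨ac, ae, be, bf, cf⟩ := hp.dists hG
  have hac : a ≠ c := by rintro rfl; simp at ac
  have hbe : b ≠ e := by rintro rfl; simp at be
  have hcf : c ≠ f := by rintro rfl; simp at cf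
  obtain ⟨z, hz, hza, hzc, -⟩ := h.exists_third hp.ab.symm hp.bc hac
  have hze := h.adj_of_adj_second hp hz hza hzc
  obtain ⟨y, hy, hyb, hye, hNc⟩ := h.exists_third hp.bc.symm hp.ce hbe
  obtain ⟨ya, yb, ye, yf⟩ := h.dists_of_adj_mid hp hy hyb hye
  obtain ⟨y', hyy', hy'⟩ := h.exists_of_dist_eq_two yf
  obtain ⟨n1, n2, n3⟩ := h.not_adj_mid hp hyy' hy' hy hyb hye
  obtain ⟨k, hyk, hka⟩ := h.exists_of_dist_eq_two ya
  obtain ⟨m1, m2, m3⟩ := h.not_adj_mid hp.reverse hyk hka hy hye hyb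
  have hp' : G.IsGeodesicFour a k y y' f := ⟨hka.symm, hyk.symm, hyy', hy', hp.dist_eq⟩
  have hya : y ≠ a := by rintro rfl; simp at ya
  have hyf : y ≠ f := by rintro rfl; simp at yf
  have hky' : k ≠ y' := by
    rintro rfl
    rw [dist_eq_one_iff_adj.2 hka] at n2
    omega
  have hck : c ≠ k := by
    rintro rfl
    rw [dist_comm, dist_eq_one_iff_adj.2 hka] at ac
    omega
  have hcy' : c ≠ y' := by
    rintro rfl
    rw [dist_eq_one_iff_adj.2 hy'] at cf
    omega
  have hzf : z ≠ f := by
    rintro rfl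
    rw [dist_eq_one_iff_adj.2 hz] at bf
    omega
  obtain ⟨ζ, hζ, hζa, hζy, hNk⟩ := h.exists_third hka hyk.symm hya.symm
  have hζy' := h.adj_of_adj_second hp' hζ hζa hζy
  have hζf : ζ ≠ f := by
    rintro rfl
    rw [dist_eq_one_iff_adj.2 hζ] at m2
    omega
  obtain ⟨w, hw, hwb, hwe, hNz⟩ := h.exists_third hz.symm hze hbe
  obtain ⟨v, hv, hvk, hvy', -⟩ := h.exists_third hζ.symm hζy' hky'
  obtain ⟨s, hs, hse, hsy', -⟩ := h.exists_third hp.ef.symm hy'.symm n1.symm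
  obtain ⟨t, ht, htb, htk, -⟩ := h.exists_third hp.ab hka.symm m1.symm
  have hsw := h.adj_of_adj_end hp hyy' hy' hy hyb hye hs hse hsy' hz hza hzc hw hwb hwe
  have htw := h.adj_of_adj_end hp.reverse hyk hka hy hye hyb ht htb htk hze.symm hzf hzc hw hwe hwb
  have hsv := h.adj_of_adj_end hp' hp.ce hp.ef hy.symm hck hcy' hs hsy' hse hζ hζa hζy hv hvk hvy'
  have htv := h.adj_of_adj_end hp'.reverse hp.bc.symm hp.ab.symm hy.symm hcy' hck ht htk htb
    hζy'.symm hζf hζy hv hvy' hvk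
  -- `w` and `v` are in the middle of the geodesics `a b z e f` and `a k ζ y' f`.
  have hq : G.IsGeodesicFour a b z e f := ⟨hp.ab, hz, hze, hp.ef, hp.dist_eq⟩
  have hq' : G.IsGeodesicFour a k ζ y' f := ⟨hka.symm, hζ, hζy', hy', hp.dist_eq⟩
  obtain ⟨wa, -, -, wf⟩ := h.dists_of_adj_mid hq hw hwb hwe
  obtain ⟨va, -, -, vf⟩ := h.dists_of_adj_mid hq' hv hvk hvy'
  obtain ⟨za, -, -, -, zf⟩ := hq.dists hG
  obtain ⟨ζa, -, -, -, ζf⟩ := hq'.dists hG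
  have ta : G.dist a t = 1 := dist_eq_one_iff_adj.2 ht
  have sf : G.dist s f = 1 := dist_eq_one_iff_adj.2 hs.symm
  have ka : G.dist a k = 1 := dist_eq_one_iff_adj.2 hka.symm
  have y'f : G.dist y' f = 1 := dist_eq_one_iff_adj.2 hy'
  have ba : G.dist a b = 1 := dist_eq_one_iff_adj.2 hp.ab
  have tf := hG.dist_le_dist_add_one ht f
  rw [hp.dist_eq] at tf
  have hst : s ≠ t := by rintro rfl; omega
  have hzt : z ≠ t := by rintro rfl; omega
  have hzs : z ≠ s := by rintro rfl; omega
  have hζt : ζ ≠ t := by rintro rfl; omega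
  have hζs : ζ ≠ s := by rintro rfl; omega
  have hbk : b ≠ k := m1.symm
  have hby' : b ≠ y' := by rintro rfl; omega
  have hek : e ≠ k := by rintro rfl; omega
  have hzζ : z ≠ ζ := by
    rintro rfl
    exact h.not_four_adj hz.symm hze hζ.symm hζy' hbe hbk hby' hek n1.symm hky'
  have hwv : w ≠ v := by
    rintro rfl
    exact h.not_four_adj hw.symm hv.symm htw.symm hsw.symm hzζ hzt hzs hζt hζs hst.symm
  have hNw : ∀ x, G.Adj w x → x = z ∨ x = t ∨ x = s := by
    obtain ⟨x, -, hxz, hxt, hN⟩ := h.exists_third hw.symm htw.symm hzt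
    have := hN s hsw.symm
    have : s = x := by grind
    rwa [this]
  have hNy : ∀ x, G.Adj y x → x = c ∨ x = y' ∨ x = k := by
    obtain ⟨x, -, hxz, hxt, hN⟩ := h.exists_third hy.symm hyy' hcy'
    have := hN k hyk
    have : k = x := by grind
    rwa [this]
  have hzk : z ≠ k := by rintro rfl; omega
  have hzy' : z ≠ y' := by rintro rfl; omega
  have hwy : w ≠ y := by
    rintro rfl
    have := hNy z hw.symm
    tauto
  have hyz : y ≠ z := by rintro rfl; rw [dist_eq_one_iff_adj.2 hz.symm] at yb; omega
  have hyt : y ≠ t := by rintro rfl; rw [dist_comm] at ya; omega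
  have hys : y ≠ s := by rintro rfl; omega
  have hwy' : ¬ G.Adj w y := fun hadj => by
    have := hNw y hadj
    tauto
  have hte : t ≠ e := by rintro rfl; omega
  have hsb : s ≠ b := by rintro rfl; omega
  have hsc : s ≠ c := by rintro rfl; omega
  have htc : t ≠ c := by rintro rfl; omega
  have hty' : t ≠ y' := by rintro rfl; omega
  have hsk : s ≠ k := by rintro rfl; rw [dist_comm] at m2; rw [dist_comm] at sf; omega
  have hwy4 : G.dist w y = 4 := by
    refine le_antisymm (h.dist_le w y) ?_
    by_contra! hlt
    obtain ⟨p, p', hp1, hp2, hpp⟩ := h.exists_of_dist_le_three (by omega) hwy hwy'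
    rcases hNw p hp1 with rfl | rfl | rfl
    · rcases hNy p' hp2 with rfl | rfl | rfl
      · exact hpp.elim hzc fun e' => h.not_triangle hz hp.bc e'
      · refine hpp.elim hzy' fun e' => ?_
        rcases hNz _ e' with rfl | rfl | rfl
        · exact hby' rfl
        · exact n1 rfl
        · omega
      · refine hpp.elim hzk fun e' => ?_
        rcases hNz _ e' with rfl | rfl | rfl
        · exact hbk rfl
        · exact hek rfl
        · rw [dist_comm] at wa; omega
    · rcases hNy p' hp2 with rfl | rfl | rfl
      · refine hpp.elim htc fun e' => ?_
        have := hNc _ e'.symm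
        grind
      · refine hpp.elim hty' fun e' => ?_
        have := hG.dist_le_dist_add_one e'.symm a
        rw [dist_comm (u := p)] at this
        omega
      · exact hpp.elim htk fun e' => h.not_triangle ht hka.symm e'
    · rcases hNy p' hp2 with rfl | rfl | rfl
      · refine hpp.elim hsc fun e' => ?_
        have := hNc _ e'.symm
        grind
      · exact hpp.elim hsy' fun e' => h.not_triangle hs hy'.symm e'
      · refine hpp.elim hsk fun e' => ?_
        have := hG.dist_le_dist_add_one e'.symm f
        have := hG.dist_le_dist_add_one hka.symm f
        omega
  have hr : G.IsGeodesicFour w t a k y := ⟨htw.symm, ht.symm, hka.symm, hyk.symm, hwy4⟩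
  have hvk' := h.adj_of_adj_second hr htv hwv.symm (by rintro rfl; simp at va)
  rcases hNk v hvk'.symm with rfl | rfl | rfl
  · simp at va
  · exact h.not_triangle hζ hyk.symm hv
  · exact hv.ne rfl

end IsTightCubic

/-! ### Vertices at distance three in diameter three -/

/-- The vertex `a` has exactly the three distinct neighbors `x`, `y`, `z`. -/
structure HasNeighbors (G : SimpleGraph V) (a x y z : V) : Prop where
  adj₁ : G.Adj a x
  adj₂ : G.Adj a y
  adj₃ : G.Adj a z
  ne₁₂ : x ≠ y
  ne₁₃ : x ≠ z
  ne₂₃ : y ≠ z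
  eq_of_adj : ∀ w, G.Adj a w → w = x ∨ w = y ∨ w = z

namespace HasNeighbors

variable {a x y z : V}

theorem rotate (h : G.HasNeighbors a x y z) : G.HasNeighbors a y z x :=
  ⟨h.adj₂, h.adj₃, h.adj₁, h.ne₂₃, h.ne₁₂.symm, h.ne₁₃.symm, fun w hw => by
    have := h.eq_of_adj w hw; tauto⟩

theorem swap (h : G.HasNeighbors a x y z) : G.HasNeighbors a y x z :=
  ⟨h.adj₂, h.adj₁, h.adj₃, h.ne₁₂.symm, h.ne₂₃, h.ne₁₃, fun w hw => by
    have := h.eq_of_adj w hw; tauto⟩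

end HasNeighbors

namespace IsTightCubic

theorem hasNeighbors {d : ℕ} (h : G.IsTightCubic d) {a x y z : V} (hx : G.Adj a x)
    (hy : G.Adj a y) (hz : G.Adj a z) (hxy : x ≠ y) (hxz : x ≠ z) (hyz : y ≠ z) :
    G.HasNeighbors a x y z := by
  refine ⟨hx, hy, hz, hxy, hxz, hyz, fun w hw => ?_⟩
  by_contra! hne
  exact h.not_four_adj hx hy hz hw hxy hxz hne.1.symm hyz hne.2.1.symm hne.2.2.symm

theorem exists_hasNeighbors {d : ℕ} (h : G.IsTightCubic d) {a x : V} (hx : G.Adj a x) :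
    ∃ y z, G.HasNeighbors a x y z := by
  obtain ⟨y, z, hy, hz, hyx, hzx, hzy, hN⟩ := h.exists_nbrs hx
  exact ⟨y, z, hx, hy, hz, hyx.symm, hzx.symm, hzy.symm, hN⟩

theorem exists_hasNeighbors_of_adj {d : ℕ} (h : G.IsTightCubic d) {a x y : V} (hx : G.Adj a x)
    (hy : G.Adj a y) (hxy : x ≠ y) : ∃ z, G.HasNeighbors a x y z := by
  obtain ⟨z, hz, hzx, hzy, hN⟩ := h.exists_third hx hy hxy
  exact ⟨z, hx, hy, hz, hxy, hzx.symm, hzy.symm, hN⟩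

variable {u v p q c t s r x y : V}

theorem dist_eq_three_iff (h : G.IsTightCubic 3) (hu : G.HasNeighbors u v c t) :
    G.dist x u = 3 ↔ x ≠ u ∧ x ≠ v ∧ x ≠ c ∧ x ≠ t ∧
      ¬ G.Adj x v ∧ ¬ G.Adj x c ∧ ¬ G.Adj x t := by
  have hG := h.conn
  have key : ∀ w, G.Adj u w → G.dist x u ≤ G.dist x w + 1 := fun w hw =>
    hG.dist_le_dist_add_one' hw x
  constructor
  · intro hd
    have h1 := key v hu.adj₁
    have h2 := key c hu.adj₂
    have h3 := key t hu.adj₃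
    refine ⟨?_, ?_, ?_, ?_, fun e => ?_, fun e => ?_, fun e => ?_⟩
    · rintro rfl; simp at hd
    · rintro rfl; simp at h1; omega
    · rintro rfl; simp at h2; omega
    · rintro rfl; simp at h3; omega
    · rw [dist_eq_one_iff_adj.2 e] at h1; omega
    · rw [dist_eq_one_iff_adj.2 e] at h2; omega
    · rw [dist_eq_one_iff_adj.2 e] at h3; omega
  · rintro ⟨h1, h2, h3, h4, h5, h6, h7⟩
    refine le_antisymm (h.dist_le x u) ?_
    by_contra! hlt
    obtain ⟨w, huw, hw⟩ := hG.exists_adj_dist_eq h1.symm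
    rw [dist_comm] at hw
    have far : w ≠ x → G.Adj x w := fun hne =>
      dist_eq_one_iff_adj.1 (by
        have := hG.pos_dist_of_ne hne
        rw [dist_comm]
        omega)
    rcases hu.eq_of_adj w huw with rfl | rfl | rfl
    · exact h5 (far h2.symm)
    · exact h6 (far h3.symm)
    · exact h7 (far h4.symm)

theorem dist_lt_of_adj_adj (h : G.IsTightCubic 3) (hv : G.HasNeighbors v u p q)
    (hx : G.Adj p x ∨ G.Adj q x) (hxu : G.dist x u = 3) : G.dist x v < G.dist x u := by
  have h1 := h.conn.dist_le_dist_add_one' hv.adj₂ x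
  have h2 := h.conn.dist_le_dist_add_one' hv.adj₃ x
  rcases hx with e | e
  · rw [dist_eq_one_iff_adj.2 e.symm] at h1; omega
  · rw [dist_eq_one_iff_adj.2 e.symm] at h2; omega

/-- In diameter three, exactly one vertex is at distance two from `v` and three from the neighbor
`u` of `v`: the other vertices closer to `v` than to `u` are `v` and its other two neighbors. -/
theorem exists_far (h : G.IsTightCubic 3) (hv : G.HasNeighbors v u p q) :
    ∃ f, (G.Adj p f ∨ G.Adj q f) ∧ G.dist f u = 3 ∧
      ∀ x, (G.Adj p x ∨ G.Adj q x) → G.dist x u = 3 → x = f := by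
  classical
  have hG := h.conn
  have hfin := h.finite
  have uv : G.dist v u = 1 := dist_eq_one_iff_adj.2 hv.adj₁
  have dist_two : ∀ {w}, G.Adj v w → w ≠ u → G.dist w v < G.dist w u := by
    intro w hw hwu
    rw [dist_eq_one_iff_adj.2 hw.symm]
    have e1 := hG.pos_dist_of_ne hwu
    have e2 : G.dist w u ≠ 1 := fun e =>
      h.not_triangle hv.adj₁ hw (dist_eq_one_iff_adj.1 e).symm
    omega
  have hcard : ({v, p, q} : Finset V).card = 3 := Finset.card_eq_three.2
    ⟨v, p, q, hv.adj₂.ne, hv.adj₃.ne, hv.ne₂₃, rfl⟩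
  obtain ⟨f, hf, hfs⟩ : ∃ f, G.dist f v < G.dist f u ∧ f ∉ ({v, p, q} : Finset V) := by
    by_contra! hall
    have := Set.ncard_le_ncard (s := {x | G.dist x v < G.dist x u})
      (t := (({v, p, q} : Finset V) : Set V)) hall (Set.toFinite _)
    rw [Set.ncard_coe_finset, h.ncard_eq hv.adj₁, hcard] at this
    omega
  have hmem : ∀ {x}, G.dist x v < G.dist x u → x ∈ insert f ({v, p, q} : Finset V) := by
    intro x hx
    refine h.mem_of_card hv.adj₁ ?_ ?_ hx
    · intro y hy
      simp only [Finset.mem_insert, Finset.mem_singleton] at hy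
      rcases hy with rfl | rfl | rfl | rfl
      · exact hf
      · rw [dist_self, uv]; norm_num
      · exact dist_two hv.adj₂ hv.ne₁₂.symm
      · exact dist_two hv.adj₃ hv.ne₁₃.symm
    · rw [Finset.card_insert_of_notMem hfs, hcard]
  simp only [Finset.mem_insert, Finset.mem_singleton, not_or] at hfs hmem
  obtain ⟨hfv, hfp, hfq⟩ := hfs
  obtain ⟨w, hvw, hw⟩ := hG.exists_adj_dist_eq (Ne.symm hfv)
  have h3 := h.dist_le f u
  rw [dist_comm] at hw
  have hwf : w ≠ f := by
    rintro rfl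
    rcases hv.eq_of_adj w hvw with rfl | rfl | rfl
    · simp at hf
    · exact hfp rfl
    · exact hfq rfl
  have hwf' : G.Adj w f := dist_eq_one_iff_adj.1 (by
    have := hG.pos_dist_of_ne hwf
    omega)
  have hwf1 : G.dist w f = 1 := dist_eq_one_iff_adj.2 hwf'
  refine ⟨f, ?_, by omega, fun x hx hxu => ?_⟩
  · rcases hv.eq_of_adj w hvw with rfl | rfl | rfl
    · rw [dist_comm] at hwf1
      omega
    · exact Or.inl hwf'
    · exact Or.inr hwf'
  · rcases hmem (h.dist_lt_of_adj_adj hv hx hxu) with e | rfl | rfl | rfl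
    · exact e
    · omega
    · have := h.conn.dist_le_dist_add_one hv.adj₂.symm u
      omega
    · have := h.conn.dist_le_dist_add_one hv.adj₃.symm u
      omega

theorem eq_of_far (h : G.IsTightCubic 3) (hv : G.HasNeighbors v u p q)
    (hx : G.Adj p x ∨ G.Adj q x) (hxu : G.dist x u = 3) (hy : G.Adj p y ∨ G.Adj q y)
    (hyu : G.dist y u = 3) : x = y := by
  obtain ⟨f, -, -, hf⟩ := h.exists_far hv
  rw [hf x hx hxu, hf y hy hyu]

theorem pendant_far_iff (h : G.IsTightCubic 3) (hu : G.HasNeighbors u v c t)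
    (hp : G.HasNeighbors p v c s) : G.dist s u = 3 ↔ s ≠ t ∧ ¬ G.Adj s t := by
  rw [h.dist_eq_three_iff hu]
  have nt := @h.not_triangle
  obtain ⟨a1, a2, a3, a4, a5, a6, a7⟩ := hu
  obtain ⟨b1, b2, b3, b4, b5, b6, b7⟩ := hp
  constructor
  · tauto
  · rintro ⟨h1, h2⟩
    refine ⟨?_, b5.symm, b6.symm, h1, ?_, ?_, h2⟩
    · rintro rfl
      exact nt a1.symm b1.symm b3.symm
    · intro e
      exact nt b1 b3 e.symm
    · intro e
      exact nt b2 b3 e.symm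

/-- If all neighbors of `v` are adjacent to `c`, then the only vertex at distance two from `v` and
three from `u` is one of the third neighbors `s`, `r` of the other two neighbors of `v`. -/
theorem pendant_far_or (h : G.IsTightCubic 3) (hv : G.HasNeighbors v u p q)
    (hp : G.HasNeighbors p v c s) (hq : G.HasNeighbors q v c r) (hcu : G.Adj c u) :
    (G.dist s u = 3 ∨ G.dist r u = 3) ∧ (G.dist s u = 3 → G.dist r u = 3 → s = r) := by
  refine ⟨?_, fun h1 h2 => h.eq_of_far hv (Or.inl hp.adj₃) h1 (Or.inr hq.adj₃) h2⟩
  obtain ⟨f, hf, hfu, -⟩ := h.exists_far hv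
  have hvu : G.dist v u = 1 := dist_eq_one_iff_adj.2 hv.adj₁
  have hcu' : G.dist c u = 1 := dist_eq_one_iff_adj.2 hcu
  rcases hf with e | e
  · rcases hp.eq_of_adj f e with rfl | rfl | rfl
    · omega
    · omega
    · exact Or.inl hfu
  · rcases hq.eq_of_adj f e with rfl | rfl | rfl
    · omega
    · omega
    · exact Or.inr hfu

/-- Two neighbors `p`, `q` of `v` with a common third neighbor `s` far from `u` leave no second
neighbor of `u` through `t` at distance less than three from `v`, although one of the two has to be. -/
theorem false_of_eq_pendant (h : G.IsTightCubic 3) (hv : G.HasNeighbors v u p q)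
    (hu : G.HasNeighbors u v c t) (hp : G.HasNeighbors p v c s) (hq : G.HasNeighbors q v c s)
    (hsu : G.dist s u = 3) : False := by
  obtain ⟨x, y, ht⟩ := h.exists_hasNeighbors hu.adj₃.symm
  obtain ⟨f, hf, hfv, hfu⟩ := h.exists_far hu
  have hs := (h.dist_eq_three_iff hu).1 hsu
  have key : ∀ w, G.Adj t w → w ≠ u → G.dist w v = 3 := by
    intro w hw hwu
    rw [h.dist_eq_three_iff hv]
    have hwt : ∀ z, G.Adj z w → G.Adj z v → z ≠ u → w = v ∨ w = c := by
      intro z hz hzv hzu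
      rcases hv.eq_of_adj z hzv.symm with rfl | rfl | rfl
      · exact absurd rfl hzu
      · rcases hp.eq_of_adj w hz with e | e | rfl
        · exact Or.inl e
        · exact Or.inr e
        · exact absurd hw.symm hs.2.2.2.2.2.2
      · rcases hq.eq_of_adj w hz with e | e | rfl
        · exact Or.inl e
        · exact Or.inr e
        · exact absurd hw.symm hs.2.2.2.2.2.2
    have wv : w ≠ v := by
      rintro rfl
      exact h.not_triangle hu.adj₁ hu.adj₃ hw.symm
    have wc : w ≠ c := by
      rintro rfl
      exact h.not_triangle hu.adj₂ hu.adj₃ hw.symm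
    refine ⟨wv, hwu, ?_, ?_, fun e => h.not_triangle hu.adj₃ e.symm hw, fun e => ?_, fun e => ?_⟩
    · rintro rfl
      rcases hp.eq_of_adj t hw.symm with rfl | rfl | rfl
      · exact hu.ne₁₃ rfl
      · exact hu.ne₂₃ rfl
      · exact hs.2.2.2.1 rfl
    · rintro rfl
      rcases hq.eq_of_adj t hw.symm with rfl | rfl | rfl
      · exact hu.ne₁₃ rfl
      · exact hu.ne₂₃ rfl
      · exact hs.2.2.2.1 rfl
    · rcases hwt p e.symm hv.adj₂.symm hv.ne₁₂.symm with e' | e'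
      · exact wv e'
      · exact wc e'
    · rcases hwt q e.symm hv.adj₃.symm hv.ne₁₃.symm with e' | e'
      · exact wv e'
      · exact wc e'
  exact ht.ne₂₃ (h.eq_of_far hu (Or.inr ht.adj₂) (key x ht.adj₂ ht.ne₁₂.symm) (Or.inr ht.adj₃)
    (key y ht.adj₃ ht.ne₁₃.symm))

/-- In diameter three, two vertices do not have the same three neighbors: each of these neighbors
would have its third neighbor equal or adjacent to exactly one of the other two third neighbors. -/
theorem not_three_common (h : G.IsTightCubic 3) (hv : G.HasNeighbors v u p q)
    (hc : G.HasNeighbors c u p q) (hvc : v ≠ c) : False := by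
  obtain ⟨t, hu⟩ := h.exists_hasNeighbors_of_adj hv.adj₁.symm hc.adj₁.symm hvc
  obtain ⟨s, hp⟩ := h.exists_hasNeighbors_of_adj hv.adj₂.symm hc.adj₂.symm hvc
  obtain ⟨r, hq⟩ := h.exists_hasNeighbors_of_adj hv.adj₃.symm hc.adj₃.symm hvc
  have hv' := hv.rotate
  have hv'' := hv'.rotate
  have su := h.pendant_far_iff hu hp
  have ru := h.pendant_far_iff hu hq
  have tp := h.pendant_far_iff hp hu
  have rp := h.pendant_far_iff hp hq
  have tq := h.pendant_far_iff hq hu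
  have sq := h.pendant_far_iff hq hp
  have fu := h.pendant_far_or hv hp hq hc.adj₁
  have fp := h.pendant_far_or hv' hq hu hc.adj₂
  have fq := h.pendant_far_or hv'' hu hp hc.adj₃
  have n1 : s = r → False := by
    rintro rfl
    exact h.false_of_eq_pendant hv hu hp hq (fu.1.elim id id)
  have n2 : r = t → False := by
    rintro rfl
    exact h.false_of_eq_pendant hv' hp hq hu (fp.1.elim id id)
  have n3 : t = s → False := by
    rintro rfl
    exact h.false_of_eq_pendant hv'' hq hu hp (fq.1.elim id id)
  have := G.adj_comm s t
  have := G.adj_comm r t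
  have := G.adj_comm s r
  grind

end IsTightCubic

/-! ### Squares in diameter three -/

/-- The vertices `u`, `v`, `p`, `c` form a square in this cyclic order; their third neighbors are
`t`, `q`, `s`, `r`. -/
structure IsSquare (G : SimpleGraph V) (u v p c t q s r : V) : Prop where
  hu : G.HasNeighbors u v c t
  hv : G.HasNeighbors v u p q
  hp : G.HasNeighbors p v c s
  hc : G.HasNeighbors c u p r

namespace IsSquare

variable {u v p c t q s r : V}

theorem reflect (h : G.IsSquare u v p c t q s r) : G.IsSquare p v u c s q t r :=
  ⟨h.hp, h.hv.swap, h.hu, h.hc.swap⟩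

theorem reflect' (h : G.IsSquare u v p c t q s r) : G.IsSquare u c p v t r s q :=
  ⟨h.hu.swap, h.hc, h.hp.swap, h.hv⟩

theorem rotate (h : G.IsSquare u v p c t q s r) : G.IsSquare v p c u q s r t :=
  ⟨h.hv.swap, h.hp, h.hc.swap, h.hu⟩

theorem third_ne (hG : G.IsTightCubic 3) (h : G.IsSquare u v p c t q s r) : s ≠ t := by
  rintro rfl
  have h1 := hG.hasNeighbors h.hv.adj₁.symm h.hc.adj₁.symm h.hu.adj₃ h.hu.ne₁₂ h.hu.ne₁₃ h.hu.ne₂₃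
  exact hG.not_three_common h1 h.hp h.hv.ne₁₂

/-- Unless the third neighbors `s` and `t` are adjacent, a second neighbor of `q` is `s`, or at
distance at most two from `u`. -/
theorem eq_or_adj (hG : G.IsTightCubic 3) (h : G.IsSquare u v p c t q s r) (hst : ¬ G.Adj s t)
    {x : V} (hx : G.Adj q x) (hxv : x ≠ v) : x = s ∨ x = t ∨ x = r ∨ G.Adj x t := by
  have nst := h.third_ne hG
  have nqr := h.rotate.third_ne hG
  obtain ⟨hu, hv, hp, hc⟩ := h
  have nt := @hG.not_triangle
  have hsu : G.dist s u = 3 := by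
    rw [hG.dist_eq_three_iff hu]
    refine ⟨?_, hp.ne₁₃.symm, hp.ne₂₃.symm, nst, fun e => nt hp.adj₁ hp.adj₃ e.symm,
      fun e => nt hp.adj₂ hp.adj₃ e.symm, hst⟩
    rintro rfl
    exact nt hv.adj₁ hv.adj₂ hp.adj₃.symm
  by_cases hxu : G.dist x u = 3
  · exact Or.inl (hG.eq_of_far hv (Or.inr hx) hxu (Or.inl hp.adj₃) hsu)
  · rw [hG.dist_eq_three_iff hu] at hxu
    by_contra! hne
    obtain ⟨n1, n2, n3, n4⟩ := hne
    refine hxu ⟨?_, hxv, ?_, n2, fun e => nt hv.adj₃ e.symm hx, fun e => ?_, n4⟩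
    · rintro rfl
      exact nt hv.adj₁ hv.adj₃ hx.symm
    · rintro rfl
      rcases hc.eq_of_adj q hx.symm with e | e | e
      · exact hv.ne₁₃ e.symm
      · exact hv.ne₂₃ e.symm
      · exact nqr e.symm
    · rcases hc.eq_of_adj x e.symm with rfl | rfl | rfl
      · exact nt hv.adj₁ hv.adj₃ hx.symm
      · exact nt hv.adj₂ hv.adj₃ hx.symm
      · exact n3 rfl

theorem eq_or_adj_adj (hG : G.IsTightCubic 3) (h : G.IsSquare u v p c t q s r)
    (hst : ¬ G.Adj s t) {x : V} (hx : G.Adj q x) (hxv : x ≠ v) :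
    x = s ∨ x = t ∨ x = r ∨ (G.Adj x s ∧ G.Adj x t) := by
  have h1 := h.eq_or_adj hG hst hx hxv
  have h2 := h.reflect.eq_or_adj hG (fun e => hst e.symm) hx hxv
  tauto

/-- Opposite vertices of a square do not both have adjacent third neighbors. -/
theorem not_adj_adj (hG : G.IsTightCubic 3) (h : G.IsSquare u v p c t q s r) (hst : G.Adj s t)
    (hqr : G.Adj q r) : False := by
  obtain ⟨hu, hv, hp, hc⟩ := h
  have hvr : v ≠ r := by
    rintro rfl
    exact hG.not_triangle hu.adj₁ hu.adj₂ hc.adj₃.symm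
  obtain ⟨x, hq⟩ := hG.exists_hasNeighbors_of_adj hv.adj₃.symm hqr hvr
  have near : ∀ {a b w : V}, G.Adj a w → G.Adj w b → G.dist a b ≠ 3 := by
    intro a b w h1 h2
    have := hG.conn.dist_le_dist_add_one h1 b
    rw [dist_eq_one_iff_adj.2 h2] at this
    omega
  have far : ∀ {u p c s t r : V}, G.HasNeighbors v u p q → G.HasNeighbors p v c s → G.Adj s t →
      G.Adj u t → G.Adj c u → G.Adj c r → G.HasNeighbors q v r x → G.dist x u = 3 := by
    intro u p c s t r hv hp hst hut hcu hcr hq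
    obtain ⟨f, hf, hfu, -⟩ := hG.exists_far hv
    rcases hf with e | e
    · rcases hp.eq_of_adj f e with rfl | rfl | rfl
      · rw [dist_eq_one_iff_adj.2 hv.adj₁] at hfu; omega
      · rw [dist_eq_one_iff_adj.2 hcu] at hfu; omega
      · exact absurd hfu (near hst hut.symm)
    · rcases hq.eq_of_adj f e with rfl | rfl | rfl
      · rw [dist_eq_one_iff_adj.2 hv.adj₁] at hfu; omega
      · exact absurd hfu (near hcr.symm hcu)
      · exact hfu
  have hxu := far hv hp hst hu.adj₃ hc.adj₁ hc.adj₃ hq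
  have hxp := far hv.swap hu hst.symm hp.adj₃ hc.adj₂ hc.adj₃ hq
  rw [dist_comm] at hxu hxp
  exact hv.ne₁₂ (hG.eq_of_far hq.rotate.rotate (Or.inl hv.adj₁) hxu (Or.inl hv.adj₂) hxp)

/-- If neither pair of opposite vertices of a square has adjacent third neighbors, then each
third neighbor is adjacent to those of the two neighboring vertices. -/
theorem adj_adj (hG : G.IsTightCubic 3) (h : G.IsSquare u v p c t q s r) (hst : ¬ G.Adj s t)
    (hqr : ¬ G.Adj q r) : G.Adj q s ∧ G.Adj q t := by
  obtain ⟨x, y, hq⟩ := hG.exists_hasNeighbors h.hv.adj₃.symm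
  have hx := h.eq_or_adj_adj hG hst hq.adj₂ hq.ne₁₂.symm
  have hy := h.eq_or_adj_adj hG hst hq.adj₃ hq.ne₁₃.symm
  have nst := h.third_ne hG
  obtain ⟨hu, hv, hp, hc⟩ := h
  have nt := @hG.not_triangle
  have hqs : q ≠ s := by rintro rfl; exact nt hv.adj₂ hv.adj₃ hp.adj₃
  have hqt : q ≠ t := by rintro rfl; exact nt hv.adj₁ hv.adj₃ hu.adj₃
  have q2 := hq.adj₂
  have q3 := hq.adj₃
  have q4 := hq.ne₂₃
  rcases hx with rfl | rfl | rfl | ⟨x1, x2⟩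
  · rcases hy with rfl | rfl | rfl | ⟨y1, y2⟩
    · exact absurd rfl q4
    · exact ⟨q2, q3⟩
    · exact absurd q3 hqr
    · exact (nt q2 q3 y1.symm).elim
  · rcases hy with rfl | rfl | rfl | ⟨y1, y2⟩
    · exact ⟨q3, q2⟩
    · exact absurd rfl q4
    · exact absurd q3 hqr
    · exact (nt q2 q3 y2.symm).elim
  · exact absurd q2 hqr
  · rcases hy with rfl | rfl | rfl | ⟨y1, y2⟩
    · exact (nt q3 q2 x1.symm).elim
    · exact (nt q3 q2 x2.symm).elim
    · exact absurd q3 hqr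
    · exact (hG.not_three_common (hG.hasNeighbors q2.symm x1 x2 hqs hqt nst)
        (hG.hasNeighbors q3.symm y1 y2 hqs hqt nst) q4).elim

/-- If the third neighbors of `v` and `c` are adjacent, then those of `c` and `u` are not. -/
theorem not_adj_adj_next (hG : G.IsTightCubic 3) (h : G.IsSquare u v p c t q s r)
    (hqr : G.Adj q r) (hrt : G.Adj r t) : False := by
  obtain ⟨hu, hv, hp, hc⟩ := h
  have nt := @hG.not_triangle
  have hur : u ≠ r := hc.ne₁₃
  obtain ⟨x, ht⟩ := hG.exists_hasNeighbors_of_adj hu.adj₃.symm hrt.symm hur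
  have hct : c ≠ t := hu.ne₂₃
  have hqc : q ≠ c := by rintro rfl; exact nt hu.adj₁ hu.adj₂ hv.adj₃
  have hqt : q ≠ t := by rintro rfl; exact nt hv.adj₁ hv.adj₃ hu.adj₃
  have hr := hG.hasNeighbors hqr.symm hc.adj₃.symm hrt hqc hqt hct
  have near : ∀ {a b w : V}, G.Adj a w → G.Adj w b → G.dist a b ≠ 3 := by
    intro a b w h1 h2
    have := hG.conn.dist_le_dist_add_one h1 b
    rw [dist_eq_one_iff_adj.2 h2] at this
    omega
  have hxv : G.dist x v = 3 := by
    obtain ⟨f, hf, hfv, -⟩ := hG.exists_far hu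
    rcases hf with e | e
    · rcases hc.eq_of_adj f e with rfl | rfl | rfl
      · exact absurd hfv (by rw [dist_eq_one_iff_adj.2 hu.adj₁]; norm_num)
      · exact absurd hfv (by rw [dist_eq_one_iff_adj.2 hp.adj₁]; norm_num)
      · exact absurd hfv (near hqr.symm hv.adj₃.symm)
    · rcases ht.eq_of_adj f e with rfl | rfl | rfl
      · exact absurd hfv (by rw [dist_eq_one_iff_adj.2 hu.adj₁]; norm_num)
      · exact absurd hfv (near hqr.symm hv.adj₃.symm)
      · exact hfv
  have hxq : G.dist x q = 3 := by
    obtain ⟨f, hf, hfv, -⟩ := hG.exists_far hr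
    rcases hf with e | e
    · rcases hc.eq_of_adj f e with rfl | rfl | rfl
      · exact absurd hfv (near hu.adj₁ hv.adj₃)
      · exact absurd hfv (near hp.adj₁ hv.adj₃)
      · exact absurd hfv (by rw [dist_eq_one_iff_adj.2 hqr.symm]; norm_num)
    · rcases ht.eq_of_adj f e with rfl | rfl | rfl
      · exact absurd hfv (near hu.adj₁ hv.adj₃)
      · exact absurd hfv (by rw [dist_eq_one_iff_adj.2 hqr.symm]; norm_num)
      · exact hfv
  rw [dist_comm] at hxv hxq
  exact hv.adj₃.ne (hG.eq_of_far ht.rotate.rotate (Or.inl hu.adj₁) hxv (Or.inr hr.adj₁) hxq)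

/-- Opposite vertices of a square do not have adjacent third neighbors. -/
theorem not_adj (hG : G.IsTightCubic 3) (h : G.IsSquare u v p c t q s r) : ¬ G.Adj q r := by
  intro hqr
  have hst : ¬ G.Adj s t := fun hst => h.not_adj_adj hG hst hqr
  have h1 := h.not_adj_adj_next hG hqr
  have h2 := h.reflect.not_adj_adj_next hG hqr
  have h3 := h.reflect'.not_adj_adj_next hG hqr.symm
  have h4 := h.reflect'.reflect.not_adj_adj_next hG hqr.symm
  have eq_q := fun x => h.eq_or_adj_adj hG hst (x := x)
  have eq_r := fun x => h.reflect'.eq_or_adj_adj hG hst (x := x)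
  obtain ⟨hu, hv, hp, hc⟩ := h
  have nt := @hG.not_triangle
  have hvr : v ≠ r := by rintro rfl; exact nt hu.adj₁ hu.adj₂ hc.adj₃.symm
  have hcq : c ≠ q := by rintro rfl; exact nt hu.adj₁ hu.adj₂ hv.adj₃
  obtain ⟨x, hq⟩ := hG.exists_hasNeighbors_of_adj hv.adj₃.symm hqr hvr
  obtain ⟨y, hr⟩ := hG.exists_hasNeighbors_of_adj hc.adj₃.symm hqr.symm hcq
  obtain ⟨xs, xt⟩ : G.Adj x s ∧ G.Adj x t := by
    rcases eq_q x hq.adj₃ hq.ne₁₃.symm with rfl | rfl | rfl | e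
    · exact (h4 hq.adj₃).elim
    · exact (h3 hq.adj₃).elim
    · exact absurd rfl hq.ne₂₃
    · exact e
  obtain ⟨ys, yt⟩ : G.Adj y s ∧ G.Adj y t := by
    rcases eq_r y hr.adj₃ hr.ne₁₃.symm with rfl | rfl | rfl | e
    · exact (h2 hr.adj₃).elim
    · exact (h1 hr.adj₃).elim
    · exact absurd rfl hr.ne₂₃
    · exact e
  have near : ∀ {a b w : V}, G.Adj a w → G.Adj w b → G.dist a b ≠ 3 := by
    intro a b w h1 h2
    have := hG.conn.dist_le_dist_add_one h1 b
    rw [dist_eq_one_iff_adj.2 h2] at this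
    omega
  -- No vertex at distance two from `v` is at distance three from `q`.
  obtain ⟨f, hf, hfq, -⟩ := hG.exists_far hv.rotate.rotate
  rcases hf with e | e
  · rcases hu.eq_of_adj f e with rfl | rfl | rfl
    · exact absurd hfq (by rw [dist_eq_one_iff_adj.2 hv.adj₃]; norm_num)
    · exact near hc.adj₃ hqr.symm hfq
    · exact near xt.symm hq.adj₃.symm hfq
  · rcases hp.eq_of_adj f e with rfl | rfl | rfl
    · exact absurd hfq (by rw [dist_eq_one_iff_adj.2 hv.adj₃]; norm_num)
    · exact near hc.adj₃ hqr.symm hfq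
    · exact near xs.symm hq.adj₃.symm hfq

end IsSquare

/-- An injective homomorphism into a connected graph that is surjective on the neighbors of each
vertex is an isomorphism. -/
theorem Connected.nonempty_iso (hG : G.Connected) {W : Type*} {H : SimpleGraph W} (f : W → V)
    (x₀ : W) (hinj : Function.Injective f) (hadj : ∀ x y, H.Adj x y → G.Adj (f x) (f y))
    (hsurj : ∀ x v, G.Adj (f x) v → ∃ y, H.Adj x y ∧ f y = v) : Nonempty (G ≃g H) := by
  have hbij : Function.Bijective f := by
    refine ⟨hinj, fun v => ?_⟩
    by_contra hv
    obtain ⟨y, ⟨x, rfl⟩, y', hy', hyy', -⟩ :=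
      hG.exists_crossing (S := Set.range f) (x := f x₀) (t := v) ⟨x₀, rfl⟩ hv
    obtain ⟨x', -, rfl⟩ := hsurj x y' hyy'
    exact hy' ⟨x', rfl⟩
  let e : H ≃g G := ⟨Equiv.ofBijective f hbij, fun {x y} => by
    refine ⟨fun h => ?_, hadj x y⟩
    obtain ⟨z, hz, hzy⟩ := hsurj x _ h
    rwa [← hinj hzy]⟩
  exact ⟨e.symm⟩

theorem hypercube_three_adj_iff (x y : Fin 3 → Bool) : (hypercube 3).Adj x y ↔
    (x 0 ≠ y 0 ∧ x 1 = y 1 ∧ x 2 = y 2) ∨ (x 0 = y 0 ∧ x 1 ≠ y 1 ∧ x 2 = y 2) ∨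
      (x 0 = y 0 ∧ x 1 = y 1 ∧ x 2 ≠ y 2) := by
  change hammingDist x y = 1 ↔ _
  rw [hammingDist, Finset.card_filter, Fin.sum_univ_three]
  by_cases h0 : x 0 = y 0 <;> by_cases h1 : x 1 = y 1 <;> by_cases h2 : x 2 = y 2 <;>
    simp [h0, h1, h2]

/-- In diameter three, a square extends to the cube: its four third neighbors form a square too. -/
theorem IsSquare.nonempty_iso (hG : G.IsTightCubic 3) {u v p c t q s r : V}
    (h : G.IsSquare u v p c t q s r) : Nonempty (G ≃g hypercube 3) := by
  have hst : ¬ G.Adj s t := fun e => h.rotate.not_adj hG e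
  have hqr := h.not_adj hG
  obtain ⟨hqs, hqt⟩ := h.adj_adj hG hst hqr
  obtain ⟨hrs, hrt⟩ := h.reflect'.adj_adj hG hst fun e => hqr e.symm
  have nst := h.third_ne hG
  have nqr := h.rotate.third_ne hG
  obtain ⟨hu, hv, hp, hc⟩ := h
  have nt := @hG.not_triangle
  have hvs : v ≠ s := hp.ne₁₃
  have hvt : v ≠ t := hu.ne₁₃
  have hct : c ≠ t := hu.ne₂₃
  have hcs : c ≠ s := hp.ne₂₃
  have hpq : p ≠ q := hv.ne₂₃
  have hpr : p ≠ r := hc.ne₂₃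
  have huq : u ≠ q := hv.ne₁₃
  have hur : u ≠ r := hc.ne₁₃
  have hup : u ≠ p := hv.ne₁₂
  have hvc : v ≠ c := hu.ne₁₂
  have hus : u ≠ s := by rintro rfl; exact nt hv.adj₁ hv.adj₂ hp.adj₃.symm
  have hvr : v ≠ r := by rintro rfl; exact nt hu.adj₁ hu.adj₂ hc.adj₃.symm
  have hpt : p ≠ t := by rintro rfl; exact nt hu.adj₁ hu.adj₃ hv.adj₂
  have hcq : c ≠ q := by rintro rfl; exact nt hu.adj₁ hu.adj₂ hv.adj₃
  have hq := hG.hasNeighbors hv.adj₃.symm hqs hqt hvs hvt nst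
  have hr := hG.hasNeighbors hc.adj₃.symm hrs hrt hcs hct nst
  have hs := hG.hasNeighbors hp.adj₃.symm hqs.symm hrs.symm hpq hpr nqr.symm
  have ht := hG.hasNeighbors hu.adj₃.symm hqt.symm hrt.symm huq hur nqr.symm
  -- The three coordinates belong to `v`, `c`, `t`, with `u` at the origin.
  let g : Bool → Bool → Bool → V
    | false, false, false => u
    | true, false, false => v
    | false, true, false => c
    | false, false, true => t
    | true, true, false => p
    | true, false, true => q
    | false, true, true => r
    | true, true, true => s
  have ginj : ∀ a b c' a' b' c'', g a b c' = g a' b' c'' → a = a' ∧ b = b' ∧ c' = c'' := by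
    have := hu.adj₁.ne
    have := hu.adj₂.ne
    have := hu.adj₃.ne
    have := hv.adj₂.ne
    have := hv.adj₃.ne
    have := hp.adj₂.ne
    have := hp.adj₃.ne
    have := hc.adj₃.ne
    have := hqs.ne
    have := hqt.ne
    have := hrs.ne
    have := hrt.ne
    rintro (_ | _) (_ | _) (_ | _) (_ | _) (_ | _) (_ | _) <;> simp only [g] <;> grind
  have gnbr : ∀ a b c', G.HasNeighbors (g a b c') (g (!a) b c') (g a (!b) c') (g a b (!c')) := by
    rintro (_ | _) (_ | _) (_ | _)
    exacts [hu, ht.rotate, hc.swap, hr.rotate, hv, hq.rotate.swap, hp.swap, hs.rotate.swap]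
  refine hG.conn.nonempty_iso (fun x : Fin 3 → Bool => g (x 0) (x 1) (x 2)) (fun _ => false) ?_ ?_ ?_
  · intro x y hxy
    obtain ⟨h0, h1, h2⟩ := ginj _ _ _ _ _ _ hxy
    ext i
    fin_cases i <;> assumption
  · intro x y hxy
    have hN := gnbr (x 0) (x 1) (x 2)
    rw [hypercube_three_adj_iff] at hxy
    rcases hxy with ⟨h0, h1, h2⟩ | ⟨h0, h1, h2⟩ | ⟨h0, h1, h2⟩
    · rw [← h1, ← h2, Bool.eq_not.2 (Ne.symm h0)]
      exact hN.adj₁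
    · rw [← h0, ← h2, Bool.eq_not.2 (Ne.symm h1)]
      exact hN.adj₂
    · rw [← h0, ← h1, Bool.eq_not.2 (Ne.symm h2)]
      exact hN.adj₃
  · intro x w hw
    have hN := gnbr (x 0) (x 1) (x 2)
    rcases hN.eq_of_adj w hw with rfl | rfl | rfl
    · exact ⟨![!x 0, x 1, x 2], by simp [hypercube_three_adj_iff], by simp⟩
    · exact ⟨![x 0, !x 1, x 2], by simp [hypercube_three_adj_iff], by simp⟩
    · exact ⟨![x 0, x 1, !x 2], by simp [hypercube_three_adj_iff], by simp⟩

/-! ### Existence of a square and the classification -/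

theorem even_sum_card_filter_adj [DecidableRel G.Adj] (S : Finset V) :
    Even (∑ x ∈ S, (S.filter (G.Adj x)).card) := by
  classical
  induction S using Finset.induction_on with
  | empty => simp
  | insert a S ha ih =>
    simp only [Finset.card_filter] at ih ⊢
    rw [Finset.sum_insert ha, Finset.sum_insert ha, if_neg G.irrefl, zero_add]
    have : ∀ x ∈ S, (∑ y ∈ insert a S, if G.Adj x y then 1 else 0) =
        (if G.Adj a x then 1 else 0) + ∑ y ∈ S, if G.Adj x y then 1 else 0 := fun x _ => by
      rw [Finset.sum_insert ha]
      simp only [G.adj_comm]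
    rw [Finset.sum_congr rfl this, Finset.sum_add_distrib, ← add_assoc]
    exact (Even.add_self _).add ih

namespace IsTightCubic

/-- In diameter three and without squares, three edges join the other two neighbors of a
neighbor `a` of `u` to the second sphere around `u`: of the four edges that do not lead back to `a`,
exactly one leads to the third sphere. -/
theorem exists_sphere_part (h : G.IsTightCubic 3) {u a : V} (hua : G.Adj u a) [Fintype V]
    [DecidableEq V] [DecidableRel G.Adj]
    (hsq : ∀ u v p c, G.Adj u v → G.Adj v p → G.Adj p c → G.Adj c u → u ≠ p → v ≠ c → False) :
    ∃ T : Finset V, (∀ x, x ∈ T ↔ G.Adj a x ∧ x ≠ u) ∧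
      ∑ x ∈ T, (({y | G.dist y u = 2} : Finset V).filter (G.Adj x)).card = 3 := by
  have hG := h.conn
  obtain ⟨b₀, c₀, ha₀⟩ := h.exists_hasNeighbors hua.symm
  obtain ⟨f, hf, hfu, huniq⟩ := h.exists_far ha₀
  obtain ⟨b, c, ha, hcf, hu⟩ : ∃ b c, G.HasNeighbors a u b c ∧ G.Adj c f ∧
      ∀ x, (G.Adj b x ∨ G.Adj c x) → G.dist x u = 3 → x = f := by
    rcases hf with e | e
    · exact ⟨c₀, b₀, ha₀.rotate.rotate.swap, e,
        fun x hx => huniq x hx.symm⟩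
    · exact ⟨b₀, c₀, ha₀, e, huniq⟩
  have au : G.dist a u = 1 := dist_eq_one_iff_adj.2 hua.symm
  have hfa : a ≠ f := by rintro rfl; omega
  have two : ∀ {w x}, G.Adj a w → w ≠ u → G.Adj w x → x ≠ a → G.dist x u ≠ 3 →
      G.dist x u = 2 := by
    intro w x haw hwu hwx hxa hx3
    have h1 := h.dist_le x u
    have h2 : G.dist x u ≠ 0 := fun e => by
      rw [hG.dist_eq_zero_iff] at e
      subst e
      exact h.not_triangle hua hwx.symm haw
    have h3 : G.dist x u ≠ 1 := fun e =>
      hsq u a w x hua haw hwx (dist_eq_one_iff_adj.1 e) hwu.symm hxa.symm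
    omega
  obtain ⟨e, g, hb⟩ := h.exists_hasNeighbors ha.adj₂.symm
  obtain ⟨k, hc⟩ := h.exists_hasNeighbors_of_adj ha.adj₃.symm hcf hfa
  have hbf : ∀ x, G.Adj b x → x ≠ a → G.dist x u = 2 := by
    intro x hx hxa
    refine two ha.adj₂ ha.ne₁₂.symm hx hxa fun e3 => ?_
    obtain rfl := hu x (Or.inl hx) e3
    exact hsq a b x c ha.adj₂ hx hcf.symm ha.adj₃.symm hxa.symm ha.ne₂₃
  refine ⟨{b, c}, ?_, ?_⟩
  · intro x
    simp only [Finset.mem_insert, Finset.mem_singleton]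
    constructor
    · rintro (rfl | rfl)
      · exact ⟨ha.adj₂, ha.ne₁₂.symm⟩
      · exact ⟨ha.adj₃, ha.ne₁₃.symm⟩
    · rintro ⟨h1, h2⟩
      have := ha.eq_of_adj x h1
      tauto
  · rw [Finset.sum_pair ha.ne₂₃]
    have s1 : (({y | G.dist y u = 2} : Finset V).filter (G.Adj b)) = {e, g} := by
      ext x
      simp only [Finset.mem_filter, Finset.mem_univ, true_and, Finset.mem_insert,
        Finset.mem_singleton]
      constructor
      · rintro ⟨h1, h2⟩
        have := hb.eq_of_adj x h2
        have : x ≠ a := by rintro rfl; omega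
        tauto
      · rintro (rfl | rfl)
        · exact ⟨hbf _ hb.adj₂ hb.ne₁₂.symm, hb.adj₂⟩
        · exact ⟨hbf _ hb.adj₃ hb.ne₁₃.symm, hb.adj₃⟩
    have s2 : (({y | G.dist y u = 2} : Finset V).filter (G.Adj c)) = {k} := by
      ext x
      simp only [Finset.mem_filter, Finset.mem_univ, true_and, Finset.mem_singleton]
      constructor
      · rintro ⟨h1, h2⟩
        have := hc.eq_of_adj x h2
        have : x ≠ a := by rintro rfl; omega
        have : x ≠ f := by rintro rfl; omega
        tauto
      · rintro rfl
        exact ⟨two ha.adj₃ ha.ne₁₃.symm hc.adj₃ hc.ne₁₃.symm fun e3 =>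
          hc.ne₂₃ (hu x (Or.inr hc.adj₃) e3).symm, hc.adj₃⟩
    rw [s1, s2, Finset.card_pair hb.ne₂₃, Finset.card_singleton]

/-- In diameter three there is a square: otherwise the second sphere around a vertex would induce a
graph with odd degree sum nine. -/
theorem exists_square (h : G.IsTightCubic 3) {u v : V} (huv : G.Adj u v) :
    ∃ u v p c, G.Adj u v ∧ G.Adj v p ∧ G.Adj p c ∧ G.Adj c u ∧ u ≠ p ∧ v ≠ c := by
  classical
  have hG := h.conn
  have := h.finite
  have := Fintype.ofFinite V
  by_contra! hno
  obtain ⟨a₂, a₃, hu⟩ := h.exists_hasNeighbors huv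
  have hsq : ∀ u v p c, G.Adj u v → G.Adj v p → G.Adj p c → G.Adj c u → u ≠ p → v ≠ c →
      False := fun u v p c h1 h2 h3 h4 h5 h6 => h6 (hno u v p c h1 h2 h3 h4 h5)
  obtain ⟨T₁, m₁, s₁⟩ := h.exists_sphere_part hu.adj₁ hsq
  obtain ⟨T₂, m₂, s₂⟩ := h.exists_sphere_part hu.adj₂ hsq
  obtain ⟨T₃, m₃, s₃⟩ := h.exists_sphere_part hu.adj₃ hsq
  have disj : ∀ {a b : V} {S T : Finset V}, G.Adj u a → G.Adj u b → a ≠ b →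
      (∀ x, x ∈ S ↔ G.Adj a x ∧ x ≠ u) → (∀ x, x ∈ T ↔ G.Adj b x ∧ x ≠ u) → Disjoint S T := by
    intro a b S T ha hb hab hS hT
    rw [Finset.disjoint_left]
    intro x hxS hxT
    rw [hS] at hxS
    rw [hT] at hxT
    exact hsq u a x b ha hxS.1 hxT.1.symm hb.symm hxS.2.symm hab
  have hS : ({y | G.dist y u = 2} : Finset V) = T₁ ∪ (T₂ ∪ T₃) := by
    ext x
    simp only [Finset.mem_filter, Finset.mem_univ, true_and, Finset.mem_union, m₁, m₂, m₃]
    constructor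
    · intro hx
      obtain ⟨w, hxw, hwu⟩ := h.exists_of_dist_eq_two hx
      have hxu : x ≠ u := by rintro rfl; simp at hx
      rcases hu.eq_of_adj w hwu.symm with rfl | rfl | rfl
      · exact Or.inl ⟨hxw.symm, hxu⟩
      · exact Or.inr (Or.inl ⟨hxw.symm, hxu⟩)
      · exact Or.inr (Or.inr ⟨hxw.symm, hxu⟩)
    · have key : ∀ {a}, G.Adj u a → G.Adj a x → x ≠ u → G.dist x u = 2 := by
        intro a ha hax hxu
        have h1 := hG.dist_le_dist_add_one hax.symm u
        rw [dist_eq_one_iff_adj.2 ha.symm] at h1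
        have h2 := hG.pos_dist_of_ne hxu
        have h3 : G.dist x u ≠ 1 := fun e =>
          h.not_triangle ha (dist_eq_one_iff_adj.1 e).symm hax
        omega
      rintro (e | e | e)
      · exact key hu.adj₁ e.1 e.2
      · exact key hu.adj₂ e.1 e.2
      · exact key hu.adj₃ e.1 e.2
  have heven := even_sum_card_filter_adj (G := G) ({y | G.dist y u = 2} : Finset V)
  nth_rw 1 [hS] at heven
  rw [Finset.sum_union, Finset.sum_union, s₁, s₂, s₃] at heven
  · exact absurd heven (by decide)
  · exact disj hu.adj₂ hu.adj₃ hu.ne₂₃ m₂ m₃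
  · rw [Finset.disjoint_union_right]
    exact ⟨disj hu.adj₁ hu.adj₂ hu.ne₁₂ m₁ m₂, disj hu.adj₁ hu.adj₃ hu.ne₁₃ m₁ m₃⟩

theorem nonempty_iso (h : G.IsTightCubic 3) : Nonempty (G ≃g hypercube 3) := by
  obtain ⟨a⟩ := h.conn.nonempty
  obtain ⟨b, hab⟩ := h.exists_adj a
  obtain ⟨u, v, p, c, huv, hvp, hpc, hcu, hup, hvc⟩ := h.exists_square hab
  obtain ⟨t, ht⟩ := h.exists_hasNeighbors_of_adj huv hcu.symm hvc
  obtain ⟨q, hq⟩ := h.exists_hasNeighbors_of_adj huv.symm hvp hup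
  obtain ⟨s, hs⟩ := h.exists_hasNeighbors_of_adj hvp.symm hpc hvc
  obtain ⟨r, hr⟩ := h.exists_hasNeighbors_of_adj hcu hpc.symm hup
  exact IsSquare.nonempty_iso h ⟨ht, hq, hs, hr⟩

/-- The diameter is at most three. -/
theorem dist_lt_four {d : ℕ} (h : G.IsTightCubic d) {u w : V} (huw : G.dist u w = d) : d < 4 := by
  obtain ⟨x, hx, -, -⟩ := h.conn.exists_isGeodesic u w
  rw [huw] at hx
  by_contra! hd
  rcases Nat.lt_or_ge 4 d with hd' | hd'
  · exact h.false_of_five_le hd' hx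
  · obtain rfl : d = 4 := by omega
    exact h.false_of_geodesicFour ⟨hx.adj 0 (by norm_num), hx.adj 1 (by norm_num),
      hx.adj 2 (by norm_num), hx.adj 3 (by norm_num), hx.dist_eq⟩

end IsTightCubic

theorem IsNicelyDistanceBalanced.isTightCubic [Fintype V] [DecidableRel G.Adj] {d : ℕ}
    (hN : G.IsNicelyDistanceBalanced (d + 1)) (hcub : G.IsRegularOfDegree 3) (hd : 1 ≤ d)
    (hdist : ∀ u v, G.dist u v ≤ d) : G.IsTightCubic d where
  finite := inferInstance
  conn := hN.connected
  exists_adj a := by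
    have h3 : (G.neighborFinset a).card = 3 := hcub a
    obtain ⟨b, hb⟩ := Finset.card_pos.1 (show 0 < (G.neighborFinset a).card by omega)
    exact ⟨b, by simpa using hb⟩
  exists_nbrs hu := exists_neighbors hcub hu
  exists_third hu hv huv := exists_third_neighbor hcub hu hv huv
  not_triangle hab hac hbc := hN.not_triangle hcub (by omega) hab hac hbc
  dist_le := hdist
  ncard_eq huv := hN.ncard_dist_lt huv

end SimpleGraph

theorem theorem5p6 {V : Type*} [Fintype V] (G : SimpleGraph V) [DecidableRel G.Adj] (γ : ℕ)
    (hNDB : G.IsNicelyDistanceBalanced γ)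
    (hcubic : G.IsRegularOfDegree 3)
    (hd : 3 ≤ G.diam)
    (hγ : γ = G.diam + 1) :
    Nonempty (G ≃g SimpleGraph.hypercube 3) := by
  subst hγ
  have := hNDB.connected.nonempty
  have hne : G.ediam ≠ ⊤ := SimpleGraph.connected_iff_ediam_ne_top.1 hNDB.connected
  have h := hNDB.isTightCubic hcubic (by omega) fun u v => SimpleGraph.dist_le_diam hne
  obtain ⟨u, w, huw⟩ := G.exists_dist_eq_diam
  have hlt := h.dist_lt_four huw
  rw [show G.diam = 3 by omega] at h
  exact h.nonempty_iso
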